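/- Let $\Sigma$ be an alphabet with the discrete topology, and give the set $\Sigma^{\mathbb N}$ of infinite words the product topology. For $x\in\Sigma^{\mathbb N}$ let $\mathcal L(x)$ be the set of (finite) factors of $x$, i.e. of its blocks of consecutive letters. The word $x$ is recurrent if each of its factors occurs in it infinitely many times. Its shift orbit closure is $\Omega_x=\{y\in\Sigma^{\mathbb N} : \mathcal L(y)\subseteq\mathcal L(x)\}$. Its abelian closure $\mathcal A(x)$ is the set of those $y\in\Sigma^{\mathbb N}$ such that for every $v\in\mathcal L(y)$ there is $w\in\mathcal L(x)$ in which each letter occurs as often as in $v$. A subshift is a nonempty closed set $X\subseteq\Sigma^{\mathbb N}$ that is mapped into itself by the shift $x_0x_1x_2\cdots\mapsto x_1x_2x_3\cdots$; it is minimal if it contains no subshift other than itself. **Theorem.** Let $C>2$ be an integer and let $u\in\Sigma^{\mathbb N}$ be a recurrent word that has exactly $n+C$ factors of length $n$ for every $n\ge 1$. Then $\mathcal A(u)$ contains exactly two minimal subshifts. More precisely, there is a word $u^R\in\Sigma^{\mathbb N}$ such that $\mathcal L(u^R)$ is the set of reversals of the words in $\mathcal L(u)$, and for every such word $u^R$ we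 have $\Omega_u\ne\Omega_{u^R}$, and the minimal subshifts contained in $\mathcal A(u)$ are exactly $\Omega_u$ and $\Omega_{u^R}$. -/

import Mathlib

namespace InfWord

/-- The block of length `n` of the infinite word `x` that starts at position `i`. -/
def factor {α : Type*} (x : ℕ → α) (i n : ℕ) : List α :=
  List.ofFn fun j : Fin n => x (i + j)

/-- The language of `x`: the set of all its (finite, possibly empty) factors. -/
def lang {α : Type*} (x : ℕ → α) : Set (List α) :=
  {w | ∃ i n, w = factor x i n}

/-- The factor complexity of `x`: the number of factors of length `n`. -/
noncomputable def complexity {α : Type*} (x : ℕ → α) (n : ℕ) : ℕ :=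
  {w | w ∈ lang x ∧ w.length = n}.ncard

/-- `x` is recurrent if each of its factors occurs in it infinitely many times. -/
def IsRecurrent {α : Type*} (x : ℕ → α) : Prop :=
  ∀ w ∈ lang x, {i | factor x i w.length = w}.Infinite

/-- Abelian equivalence: each letter occurs equally many times in both words. -/
def AbelianEquiv {α : Type*} [DecidableEq α] (v w : List α) : Prop :=
  ∀ a, v.count a = w.count a

/-- The abelian closure of `x`. -/
def abelianClosure {α : Type*} [DecidableEq α] (x : ℕ → α) : Set (ℕ → α) :=
  {y | ∀ v ∈ lang y, ∃ w ∈ lang x, AbelianEquiv v w}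

/-- The shift operator on infinite words. -/
def shift {α : Type*} (x : ℕ → α) : ℕ → α := fun i => x (i + 1)

/-- A subshift: a nonempty set of infinite words, closed in the product topology
and mapped into itself by the shift. -/
def IsSubshift {α : Type*} [TopologicalSpace α] (X : Set (ℕ → α)) : Prop :=
  X.Nonempty ∧ IsClosed X ∧ ∀ x ∈ X, shift x ∈ X

/-- A minimal subshift: a subshift that contains no proper subshift. -/
def IsMinimalSubshift {α : Type*} [TopologicalSpace α] (X : Set (ℕ → α)) : Prop :=
  IsSubshift X ∧ ∀ Y, IsSubshift Y → Y ⊆ X → Y = X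

/-- The shift orbit closure of `x`. -/
def orbitClosure {α : Type*} (x : ℕ → α) : Set (ℕ → α) :=
  {y | lang y ⊆ lang x}

/-- `v` is a reversal of the infinite word `u`: its factors are exactly the reversals of the
factors of `u`. -/
def IsReversal {α : Type*} (v u : ℕ → α) : Prop :=
  lang v = List.reverse '' lang u

end InfWord

/-! Read the two-letter factors of `u` as the edges of a directed graph on the letters. The
complexity hypothesis gives exactly one letter with two successors and exactly one with two
predecessors, and likewise one special word on each side at every positive length. Recurrence makes
the graph strongly connected, and C > 2 provides four letters. `IsQuasiSturmianLang` records this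
information, which is invariant under reversal.

A point y of a minimal subshift inside the abelian closure is recurrent, and any two consecutive
letters of y form an edge, read forwards or backwards. The walk y cannot change direction
(`not_turn`, `forward_or_backward`): a turn would make some factor of u over very few letters return
to a letter from which there is no way back, or would close off a set of at most three letters. So,
up to reversing u, y follows the edges.

A walk that follows the edges can be decoded from the binary word recording only its visits to the
branching letter r and to one successor d of r. The codes of factors of u have a unique right
special word at each length, hence are balanced. Balance depends only on lengths and letter counts,
so abelian equivalence carries it over to the codes of y; since a balanced language cannot grow past
one that already has right special words of all lengths, every code of y is a code from u. Decoding
gives the inclusion of languages (`subset_of_abelian`).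

Both orbit closures are minimal by uniform recurrence, a consequence of `eq_of_subset`, so inclusion
becomes equality. They differ because in a reversal-closed language both edges leaving r could be
reversed, and r with its two successors would form a closed set (`neutral_unique`). -/

namespace InfWord

/-! ### Quasi-Sturmian languages: extendable sublanguages and uniform recurrence. -/

/-- The language of the reversals of the words of `L`. -/
def revLang {α : Type*} (L : Set (List α)) : Set (List α) := {w | w.reverse ∈ L}

/-- Factorial irreducible languages over a finite alphabet with at least four letters that have,
for each positive length, exactly one right special and exactly one left special word, each with
exactly two extensions. -/
structure IsQuasiSturmianLang {α : Type*} (L : Set (List α)) : Prop where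
  mem_of_infix : ∀ {v w : List α}, v <:+: w → w ∈ L → v ∈ L
  irreducible : ∀ v ∈ L, ∀ w ∈ L, ∃ z, v ++ z ++ w ∈ L
  right_unique : ∀ {x x' : List α} {a b a' b' : α}, x ≠ [] → x.length = x'.length → a ≠ b →
    a' ≠ b' → x ++ [a] ∈ L → x ++ [b] ∈ L → x' ++ [a'] ∈ L → x' ++ [b'] ∈ L →
    x = x' ∧ (a' = a ∨ a' = b)
  left_unique : ∀ {x x' : List α} {a b a' b' : α}, x ≠ [] → x.length = x'.length → a ≠ b →
    a' ≠ b' → a :: x ∈ L → b :: x ∈ L → a' :: x' ∈ L → b' :: x' ∈ L →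
    x = x' ∧ (a' = a ∨ a' = b)
  exists_right : ∀ n : ℕ, n ≠ 0 → ∃ (x : List α) (a b : α), x.length = n ∧ a ≠ b ∧
    x ++ [a] ∈ L ∧ x ++ [b] ∈ L
  exists_left : ∀ n : ℕ, n ≠ 0 → ∃ (x : List α) (a b : α), x.length = n ∧ a ≠ b ∧
    a :: x ∈ L ∧ b :: x ∈ L
  finite_letters : {a | [a] ∈ L}.Finite
  exists_fourth : ∀ a b c : α, ∃ d, [d] ∈ L ∧ d ≠ a ∧ d ≠ b ∧ d ≠ c

variable {α : Type*} {L K : Set (List α)}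

theorem IsQuasiSturmianLang.reverse (h : IsQuasiSturmianLang L) :
    IsQuasiSturmianLang (revLang L) where
  mem_of_infix := fun hvw hw => h.mem_of_infix (List.reverse_infix.2 hvw) hw
  irreducible := fun v hv w hw => by
    obtain ⟨z, hz⟩ := h.irreducible _ hw _ hv
    exact ⟨z.reverse, by simpa [revLang] using hz⟩
  right_unique := fun {x x' a b a' b'} hx hl hab hab' h1 h2 h3 h4 => by
    have := h.left_unique (x := x.reverse) (x' := x'.reverse) (by simpa using hx) (by simpa using hl)
      hab hab' (by simpa [revLang] using h1) (by simpa [revLang] using h2)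
      (by simpa [revLang] using h3) (by simpa [revLang] using h4)
    simpa using this
  left_unique := fun {x x' a b a' b'} hx hl hab hab' h1 h2 h3 h4 => by
    have := h.right_unique (x := x.reverse) (x' := x'.reverse) (by simpa using hx)
      (by simpa using hl) hab hab' (by simpa [revLang] using h1) (by simpa [revLang] using h2)
      (by simpa [revLang] using h3) (by simpa [revLang] using h4)
    simpa using this
  exists_right := fun n hn => by
    obtain ⟨x, a, b, hx, hab, h1, h2⟩ := h.exists_left n hn
    exact ⟨x.reverse, a, b, by simpa using hx, hab, by simpa [revLang] using h1,
      by simpa [revLang] using h2⟩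
  exists_left := fun n hn => by
    obtain ⟨x, a, b, hx, hab, h1, h2⟩ := h.exists_right n hn
    exact ⟨x.reverse, a, b, by simpa using hx, hab, by simpa [revLang] using h1,
      by simpa [revLang] using h2⟩
  finite_letters := by simpa [revLang] using h.finite_letters
  exists_fourth := by simpa [revLang] using h.exists_fourth

/-- A word that leaves the factorial set `K` has a factor of each large length in `K` that is
followed by a letter with which it is no longer in `K`. -/
theorem exists_exit (hL : ∀ {v w : List α}, v <:+: w → w ∈ L → v ∈ L)
    (hK : ∀ {v w : List α}, v <:+: w → w ∈ K → v ∈ K) {w : List α} (hw : w ∉ K) (t : List α) :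
    ∀ x ∈ K, w.length ≤ x.length → x ++ t ∈ L → w <:+ x ++ t →
      ∃ v ∈ K, v.length = x.length ∧ ∃ c, v ++ [c] ∈ L ∧ v ++ [c] ∉ K := by
  induction t with
  | nil =>
    intro x hx _ _ hs
    exact absurd (hK (List.IsSuffix.isInfix (by simpa using hs)) hx) hw
  | cons a t ih =>
    intro x hx hlen hxt hs
    by_cases hxa : x ++ [a] ∈ K
    · cases x with
      | nil =>
        have : w = [] := by simpa using hlen
        exact absurd (this ▸ hx) hw
      | cons b x =>
        -- The window drops its first letter `b` and takes in `a`; as `w` is no longer than the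
        -- window, it remains a suffix of the rest.
        have e : b :: x ++ a :: t = b :: (x ++ [a] ++ t) := by simp
        rw [e] at hxt hs
        have hsuf : x ++ [a] ++ t <:+ b :: (x ++ [a] ++ t) := List.suffix_cons _ _
        have := ih (x ++ [a]) (hK ⟨[b], [], by simp⟩ hxa) (by simpa using hlen)
          (hL hsuf.isInfix hxt)
          (List.suffix_of_suffix_length_le hs hsuf (by simp at hlen ⊢; omega))
        simpa using this
    · exact ⟨x, hx, rfl, a, hL ⟨[], t, by simp⟩ hxt, hxa⟩

theorem exists_mem_length (h0 : [] ∈ K) (hr : ∀ x ∈ K, ∃ a, x ++ [a] ∈ K) (n : ℕ) :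
    ∃ x ∈ K, x.length = n := by
  induction n with
  | zero => exact ⟨[], h0, rfl⟩
  | succ n ih =>
    obtain ⟨x, hx, hn⟩ := ih
    obtain ⟨a, ha⟩ := hr x hx
    exact ⟨_, ha, by simp [hn]⟩

theorem IsQuasiSturmianLang.exists_right_exit (h : IsQuasiSturmianLang L)
    (hKL : K ⊆ L) (hK : ∀ {v w : List α}, v <:+: w → w ∈ K → v ∈ K)
    (h0 : [] ∈ K) (hr : ∀ x ∈ K, ∃ a, x ++ [a] ∈ K)
    {w : List α} (hwL : w ∈ L) (hw : w ∉ K) {n : ℕ} (hn : w.length ≤ n) :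
    ∃ v ∈ K, v.length = n ∧ ∃ c, v ++ [c] ∈ L ∧ v ++ [c] ∉ K := by
  obtain ⟨x, hx, rfl⟩ := exists_mem_length h0 hr n
  obtain ⟨z, hz⟩ := h.irreducible x (hKL hx) w hwL
  exact exists_exit h.mem_of_infix hK hw (z ++ w) x hx hn (by simpa using hz)
    ⟨x ++ z, by simp⟩

/-- An exit word of `K` has one continuation inside `K` and one outside, so it is right special in
`L`; by uniqueness it is `x`. -/
theorem IsQuasiSturmianLang.right_special_mem (h : IsQuasiSturmianLang L)
    (hKL : K ⊆ L) (hK : ∀ {v w : List α}, v <:+: w → w ∈ K → v ∈ K)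
    (h0 : [] ∈ K) (hr : ∀ x ∈ K, ∃ a, x ++ [a] ∈ K)
    {w : List α} (hwL : w ∈ L) (hw : w ∉ K) {x : List α} (hn : w.length ≤ x.length) {a b : α}
    (hab : a ≠ b) (ha : x ++ [a] ∈ L) (hb : x ++ [b] ∈ L) : x ∈ K := by
  obtain ⟨v, hv, hvn, c, hc, hcK⟩ := h.exists_right_exit hKL hK h0 hr hwL hw hn
  obtain ⟨d, hd⟩ := hr v hv
  have hv0 : v ≠ [] := by
    rintro rfl
    simp only [List.length_nil] at hvn
    have : w = [] := by rw [← List.length_eq_zero_iff]; omega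
    exact hw (this ▸ h0)
  rw [← (h.right_unique hv0 hvn (a := c) (b := d) (by rintro rfl; exact hcK hd) hab hc (hKL hd)
    ha hb).1]
  exact hv

theorem IsQuasiSturmianLang.exists_left_exit (h : IsQuasiSturmianLang L)
    (hKL : K ⊆ L) (hK : ∀ {v w : List α}, v <:+: w → w ∈ K → v ∈ K)
    (h0 : [] ∈ K) (hl : ∀ x ∈ K, ∃ a, a :: x ∈ K)
    {w : List α} (hwL : w ∈ L) (hw : w ∉ K) {n : ℕ} (hn : w.length ≤ n) :
    ∃ v ∈ K, v.length = n ∧ ∃ c, c :: v ∈ L ∧ c :: v ∉ K := by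
  obtain ⟨v, hv, hvn, c, hc, hcK⟩ := h.reverse.exists_right_exit (K := revLang K)
    (fun x hx => hKL hx) (fun hvw hw => hK (List.reverse_infix.2 hvw) hw) h0
    (fun x hx => by simpa [revLang] using hl _ hx) (w := w.reverse) (by simpa [revLang] using hwL)
    (by simpa [revLang] using hw) (n := n) (by simpa using hn)
  exact ⟨v.reverse, hv, by simpa using hvn, c, by simpa [revLang] using hc,
    by simpa [revLang] using hcK⟩

theorem IsQuasiSturmianLang.left_special_mem (h : IsQuasiSturmianLang L)
    (hKL : K ⊆ L) (hK : ∀ {v w : List α}, v <:+: w → w ∈ K → v ∈ K)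
    (h0 : [] ∈ K) (hl : ∀ x ∈ K, ∃ a, a :: x ∈ K)
    {w : List α} (hwL : w ∈ L) (hw : w ∉ K) {x : List α} (hn : w.length ≤ x.length) {a b : α}
    (hab : a ≠ b) (ha : a :: x ∈ L) (hb : b :: x ∈ L) : x ∈ K := by
  have := h.reverse.right_special_mem (K := revLang K)
    (fun x hx => hKL hx) (fun hvw hw => hK (List.reverse_infix.2 hvw) hw) h0
    (fun x hx => by simpa [revLang] using hl _ hx) (w := w.reverse) (by simpa [revLang] using hwL)
    (by simpa [revLang] using hw) (x := x.reverse) (by simpa using hn) hab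
    (by simpa [revLang] using ha) (by simpa [revLang] using hb)
  simpa [revLang] using this

/-- If `w` were missing, some `a :: p` would leave `K` on the left. Follow a path of `L` from it
towards `w` until the part `x` after `a` is about to leave `K`. The left special word one letter
longer than `x` lies in `K` and extends `x`, which gives `a :: x` a second continuation. So `a :: x`
is right special and outside `K`, although all long right special words lie in `K`. -/
theorem IsQuasiSturmianLang.eq_of_subset (h : IsQuasiSturmianLang L)
    (hKL : K ⊆ L) (hK : ∀ {v w : List α}, v <:+: w → w ∈ K → v ∈ K)
    (h0 : [] ∈ K) (hr : ∀ x ∈ K, ∃ a, x ++ [a] ∈ K) (hl : ∀ x ∈ K, ∃ a, a :: x ∈ K) : K = L := by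
  refine hKL.antisymm fun w hwL => ?_
  by_contra hw
  obtain ⟨p, hpK, hpn, a, hap, hapK⟩ := h.exists_left_exit hKL hK h0 hl hwL hw le_rfl
  obtain ⟨z, hz⟩ := h.irreducible _ hap w hwL
  have key : ∀ t x : List α, x ∈ K → p <+: x → a :: x ++ t ∈ L → w <:+ x ++ t →
      ∃ y ∈ K, p <+: y ∧ ∃ c, a :: y ++ [c] ∈ L ∧ y ++ [c] ∉ K := by
    intro t
    induction t with
    | nil => exact fun x hx _ _ hs => absurd (hK (List.IsSuffix.isInfix (by simpa using hs)) hx) hw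
    | cons c t ih =>
      intro x hx hpx hxt hs
      by_cases hxc : x ++ [c] ∈ K
      · exact ih (x ++ [c]) hxc (hpx.trans (List.prefix_append _ _)) (by simpa using hxt)
          (by simpa using hs)
      · exact ⟨x, hx, hpx, c, h.mem_of_infix ⟨[], t, by simp⟩ hxt, hxc⟩
  obtain ⟨x, hx, hpx, c, hc, hcK⟩ := key (z ++ w) p hpK (List.prefix_refl _) (by simpa using hz)
    ⟨p ++ z, by simp⟩
  have hwx : w.length ≤ x.length := hpn ▸ hpx.length_le
  have hw0 : w ≠ [] := fun e => hw (e ▸ h0)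
  have hx0 : x ≠ [] := by
    rintro rfl
    exact hw0 (by simpa using hwx)
  have haxK : a :: x ∉ K := fun hax =>
    hapK (hK (List.IsPrefix.isInfix (by simpa using hpx)) hax)
  have hax : a :: x ∈ L := h.mem_of_infix ⟨[], [c], by simp⟩ hc
  obtain ⟨a', ha'⟩ := hl x hx
  have haa' : a ≠ a' := by rintro rfl; exact haxK ha'
  obtain ⟨y, b, b', hyn, hbb, hb, hb'⟩ := h.exists_left (x.length + 1) (by simp)
  have hy := h.left_special_mem hKL hK h0 hl hwL hw (x := y) (by omega) hbb hb hb'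
  obtain ⟨y', e, rfl⟩ : ∃ y' e, y = y' ++ [e] :=
    ⟨y.dropLast, y.getLast (by rintro rfl; simp at hyn), (List.dropLast_append_getLast _).symm⟩
  have hbn : b :: y' ∈ L := h.mem_of_infix ⟨[], [e], by simp⟩ hb
  have hbn' : b' :: y' ∈ L := h.mem_of_infix ⟨[], [e], by simp⟩ hb'
  have hl1 : x.length = y'.length := by simp at hyn; omega
  obtain ⟨rfl, hbb1⟩ := h.left_unique hx0 hl1 haa' hbb hax (hKL ha') hbn hbn'
  obtain ⟨-, hbb2⟩ := h.left_unique hx0 hl1 haa' hbb.symm hax (hKL ha') hbn' hbn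
  -- The left extensions of `x ++ [e]` are the two left extensions of `x`, and `a` is one of these.
  have hae : a :: (x ++ [e]) ∈ L := by
    rcases hbb1 with rfl | rfl
    · exact hb
    · rcases hbb2 with rfl | rfl
      · exact hb'
      · exact absurd rfl hbb
  exact haxK (h.right_special_mem hKL hK h0 hr hwL hw (x := a :: x) (by simp; omega)
    (a := c) (b := e) (by rintro rfl; exact hcK hy) hc (by simpa using hae))

/-- Compactness: each of the finitely many failing letters fails from some index on, so all would
fail at the largest of these indices. -/
theorem exists_common_letter {S : Set α} (hS : S.Finite) {P : α → ℕ → Prop}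
    (hP : ∀ a n m, n ≤ m → P a m → P a n) (h : ∀ n, ∃ a ∈ S, P a n) : ∃ a, ∀ n, P a n := by
  by_contra! hcon
  choose f hf using hcon
  obtain ⟨a, ha, hPa⟩ := h (hS.toFinset.sup f)
  exact hf a (hP a _ _ (Finset.le_sup (hS.mem_toFinset.2 ha)) hPa)

/-- Uniform recurrence. -/
theorem IsQuasiSturmianLang.exists_infix_of_length_le (h : IsQuasiSturmianLang L) {w : List α}
    (hw : w ∈ L) : ∃ N : ℕ, ∀ x ∈ L, N ≤ x.length → w <:+: x := by
  by_contra! hcon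
  have hfin : ∀ {x : List α}, x ∈ L → ∀ a ∈ x, [a] ∈ L := fun hx a ha =>
    h.mem_of_infix ((List.singleton_infix_iff _ _).2 ha) hx
  -- If `w` could be avoided by arbitrarily long words, the words with arbitrarily long margins on
  -- both sides inside `w`-free words of `L` would form an extendable sublanguage. It would be all
  -- of `L`, yet it omits `w`.
  have := h.eq_of_subset
    (K := {x | ∀ N : ℕ, ∃ p q : List α, N ≤ p.length ∧ N ≤ q.length ∧ p ++ x ++ q ∈ L ∧
      ¬ w <:+: p ++ x ++ q}) ?_ ?_ ?_ ?_ ?_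
  · obtain ⟨p, q, -, -, -, hn⟩ := this.ge hw 0
    exact hn ⟨p, q, rfl⟩
  · intro x hx
    obtain ⟨p, q, -, -, hL, -⟩ := hx 0
    exact h.mem_of_infix ⟨p, q, rfl⟩ hL
  · rintro v w ⟨s, t, rfl⟩ hx N
    obtain ⟨p, q, hp, hq, hL, hn⟩ := hx N
    exact ⟨p ++ s, t ++ q, by simp; omega, by simp; omega, by simpa using hL, by simpa using hn⟩
  · intro N
    obtain ⟨x, hx, hN, hn⟩ := hcon (N + N)
    exact ⟨x.take N, x.drop N, by simp; omega, by simp; omega, by simpa using hx, by simpa using hn⟩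
  · intro x hx
    refine exists_common_letter h.finite_letters (P := fun a N => ∃ p q : List α, N ≤ p.length ∧
      N ≤ q.length ∧ p ++ (x ++ [a]) ++ q ∈ L ∧ ¬ w <:+: p ++ (x ++ [a]) ++ q) ?_ ?_
    · rintro a n m hnm ⟨p, q, hp, hq, h1⟩
      exact ⟨p, q, hnm.trans hp, hnm.trans hq, h1⟩
    · intro N
      obtain ⟨p, q, hp, hq, hL, hn⟩ := hx (N + 1)
      cases q with
      | nil => simp at hq
      | cons a q =>
        exact ⟨a, hfin hL a (by simp), p, q, by omega, by simpa using hq, by simpa using hL,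
          by simpa using hn⟩
  · intro x hx
    refine exists_common_letter h.finite_letters (P := fun a N => ∃ p q : List α, N ≤ p.length ∧
      N ≤ q.length ∧ p ++ (a :: x) ++ q ∈ L ∧ ¬ w <:+: p ++ (a :: x) ++ q) ?_ ?_
    · rintro a n m hnm ⟨p, q, hp, hq, h1⟩
      exact ⟨p, q, hnm.trans hp, hnm.trans hq, h1⟩
    · intro N
      obtain ⟨p, q, hp, hq, hL, hn⟩ := hx (N + 1)
      rcases List.eq_nil_or_concat p with rfl | ⟨p, a, rfl⟩
      · simp at hp
      · exact ⟨a, hfin hL a (by simp), p, q, by simpa using hp, by omega, by simpa using hL,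
          by simpa using hn⟩

end InfWord

/-! ### Binary languages: unique right special words and balance. -/

namespace InfWord

section Binary

variable {B : Set (List Bool)}

theorem eq_of_count_take : ∀ l l' : List Bool, l.length = l'.length →
    (∀ k, (l.take k).count true = (l'.take k).count true) → l = l'
  | [], [], _, _ => rfl
  | a :: l, b :: l', hl, h => by
    have h1 : a = b := by
      have := h 1
      cases a <;> cases b <;> simp_all
    subst h1
    congr 1
    refine eq_of_count_take l l' (by simpa using hl) fun k => ?_
    have := h (k + 1)
    simpa [List.count_cons] using this

/-- Deleting the last letter is injective once the extension by `true` of the only right special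
word is set aside, so each length adds at most one word. -/
theorem ncard_length_le (hB : ∀ {v w : List Bool}, v <:+: w → w ∈ B → v ∈ B)
    (hU : ∀ x y : List Bool, x.length = y.length → x ++ [true] ∈ B → x ++ [false] ∈ B →
      y ++ [true] ∈ B → y ++ [false] ∈ B → x = y) (n : ℕ) :
    {w | w ∈ B ∧ w.length = n}.ncard ≤ n + 1 := by
  have hfin : ∀ n, {w | w ∈ B ∧ w.length = n}.Finite := fun n =>
    (List.finite_length_eq Bool n).subset fun w hw => hw.2
  induction n with
  | zero =>
    refine (Set.ncard_le_ncard (t := {[]}) ?_).trans (by simp)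
    rintro w ⟨-, hw⟩
    simpa using hw
  | succ n ih =>
    obtain ⟨s, hs⟩ : ∃ s : List Bool, ∀ x : List Bool, x.length = n → x ++ [true] ∈ B →
        x ++ [false] ∈ B → x ++ [true] = s := by
      by_cases hex : ∃ x : List Bool, x.length = n ∧ x ++ [true] ∈ B ∧ x ++ [false] ∈ B
      · obtain ⟨x, hx, h1, h0⟩ := hex
        exact ⟨x ++ [true], fun y hy h1' h0' => by rw [hU x y (hx.trans hy.symm) h1 h0 h1' h0']⟩
      · exact ⟨[], fun x hx h1 h0 => absurd ⟨x, hx, h1, h0⟩ hex⟩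
    have h1 : ({w | w ∈ B ∧ w.length = n + 1} \ {s}).ncard ≤ {w | w ∈ B ∧ w.length = n}.ncard := by
      refine Set.ncard_le_ncard_of_injOn List.dropLast ?_ ?_ (hfin n)
      · rintro w ⟨⟨hw, hn⟩, -⟩
        exact ⟨hB (List.dropLast_prefix w).isInfix hw, by simp [hn]⟩
      · rintro v ⟨⟨hv, hvn⟩, hvs⟩ w ⟨⟨hw, hwn⟩, hws⟩ hvw
        rcases List.eq_nil_or_concat v with rfl | ⟨x, a, rfl⟩
        · simp at hvn
        rcases List.eq_nil_or_concat w with rfl | ⟨y, b, rfl⟩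
        · simp at hwn
        obtain rfl : x = y := by simpa using hvw
        have hxn : x.length = n := by simpa using hvn
        have := hs x hxn
        cases a <;> cases b <;> simp_all
    have h2 := Set.ncard_le_ncard_sdiff_add_ncard {w | w ∈ B ∧ w.length = n + 1} {s}
      (Set.finite_singleton s)
    rw [Set.ncard_singleton] at h2
    omega

/-- The factor of `V` of length `m` at position `i`. -/
def window (V : List Bool) (m i : ℕ) : List Bool := (V.drop i).take m

theorem window_infix (V : List Bool) (m i : ℕ) : window V m i <:+: V :=
  (List.take_prefix _ _).isInfix.trans (List.drop_suffix _ _).isInfix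

/-- At length |x| + 1 only `e :: x` can be right special, so reading on from `f :: x` is
deterministic until `e :: x` first appears. That occurrence cannot overlap or directly follow the
initial `f :: x`, because the next letter is `f` and `x` is a palindrome. Nor can it come later: the
windows before it would repeat, and the reading would have met `e :: x` earlier. -/
theorem not_palindrome_bispecial (hB : ∀ {v w : List Bool}, v <:+: w → w ∈ B → v ∈ B)
    (hirr : ∀ v ∈ B, ∀ w ∈ B, ∃ z, v ++ z ++ w ∈ B)
    (hU : ∀ x y : List Bool, x.length = y.length → x ++ [true] ∈ B → x ++ [false] ∈ B →
      y ++ [true] ∈ B → y ++ [false] ∈ B → x = y)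
    {x : List Bool} (hpal : x.reverse = x) {e f : Bool} (hef : e ≠ f)
    (he : e :: x ++ [e] ∈ B) (hf : f :: x ++ [f] ∈ B) (hfe : f :: x ++ [e] ∉ B) : False := by
  have hlet : ∀ a : Bool, a = e ∨ a = f := by
    intro a
    cases a <;> cases e <;> cases f <;> simp_all
  have hU' : ∀ {y y' : List Bool} {a b a' b' : Bool}, y.length = y'.length → a ≠ b → a' ≠ b' →
      y ++ [a] ∈ B → y ++ [b] ∈ B → y' ++ [a'] ∈ B → y' ++ [b'] ∈ B → y = y' := by
    have hsp : ∀ {y : List Bool} {a b : Bool}, a ≠ b → y ++ [a] ∈ B → y ++ [b] ∈ B →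
        y ++ [true] ∈ B ∧ y ++ [false] ∈ B := by
      intro y a b hab h1 h2
      cases a <;> cases b
      exacts [absurd rfl hab, ⟨h2, h1⟩, ⟨h1, h2⟩, absurd rfl hab]
    intro y y' a b a' b' hl hab hab' h1 h2 h3 h4
    exact hU _ _ hl (hsp hab h1 h2).1 (hsp hab h1 h2).2 (hsp hab' h3 h4).1 (hsp hab' h3 h4).2
  have hxe : x ++ [e] ∈ B := hB ⟨[e], [], by simp⟩ he
  have hxf : x ++ [f] ∈ B := hB ⟨[f], [], by simp⟩ hf
  set m := x.length + 1 with hm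
  have hns : ∀ y a b, y.length = m → a ≠ b → y ++ [a] ∈ B → y ++ [b] ∈ B → y = e :: x := by
    intro y a b hy hab ha hb
    cases y with
    | nil => simp [hm] at hy
    | cons c y =>
      have : y = x := hU' (by simpa [hm] using hy) hab hef (hB ⟨[c], [], by simp⟩ ha)
        (hB ⟨[c], [], by simp⟩ hb) hxe hxf
      subst this
      rcases hlet c with rfl | rfl
      · rfl
      · rcases hlet a with rfl | rfl
        · exact absurd ha hfe
        · rcases hlet b with rfl | rfl
          · exact absurd hb hfe
          · exact absurd rfl hab
  obtain ⟨z, hz⟩ := hirr (f :: x) (hB ⟨[], [f], by simp⟩ hf) (e :: x) (hB ⟨[], [e], by simp⟩ he)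
  set V := f :: x ++ z ++ e :: x with hV
  have hVlen : V.length = m + z.length + m := by simp [hV, hm]; omega
  have hex : ∃ i, window V m i = e :: x :=
    ⟨(f :: x ++ z).length, by rw [window, hV, List.drop_left]; simp [hm]⟩
  classical
  set j := Nat.find hex with hj
  have hjs : window V m j = e :: x := Nat.find_spec hex
  have hjlt : ∀ i < j, window V m i ≠ e :: x := fun i hi => Nat.find_min hex hi
  have hjV : j + m ≤ V.length := by
    have : (window V m j).length = m := by rw [hjs]; simp [hm]
    simp only [window, List.length_take, List.length_drop] at this
    omega
  have hwB : ∀ k i, window V k i ∈ B := fun k i => hB (window_infix V k i) hz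
  have hwlen : ∀ k i, i + k ≤ V.length → (window V k i).length = k := fun k i hi => by
    simp only [window, List.length_take, List.length_drop]; omega
  have hstep : ∀ i i', i < j → i' < j → window V m i = window V m i' →
      window V m (i + 1) = window V m (i' + 1) := by
    intro i i' hi hi' h
    have hsucc : ∀ i, i < j → ∃ a, window V (m + 1) i = window V m i ++ [a] := by
      intro i hi
      refine ⟨V[i + m]'(by omega), ?_⟩
      have : m < (V.drop i).length := by simp; omega
      rw [window, window, ← List.take_concat_get' _ m this]
      simp
    have hdrop : ∀ i, window V m (i + 1) = (window V (m + 1) i).drop 1 := by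
      intro i
      simp [window, List.drop_take, Nat.add_comm]
    obtain ⟨a, ha⟩ := hsucc i hi
    obtain ⟨b, hb⟩ := hsucc i' hi'
    rw [hdrop, hdrop, ha, hb, ← h]
    by_cases hab : a = b
    · rw [hab]
    · refine absurd (hns _ a b (hwlen m i (by omega)) hab (ha ▸ hwB _ _) ?_) (hjlt i hi)
      rw [h]
      exact hb ▸ hwB _ _
  have hj0 : j ≠ 0 := by
    intro h0
    rw [h0] at hjs
    simp [window, hV, hm] at hjs
    exact hef hjs.symm
  have hVm : V[m]? = some f := by
    have h1 : m < V.length := by omega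
    have h2 : f :: x ++ [V[m]] ∈ B := by
      have h3 := List.take_concat_get' V m h1
      have h4 : V.take m = f :: x := by simp [hV, hm]
      rw [h4] at h3
      rw [h3]
      exact hB (List.take_prefix _ _).isInfix hz
    rw [List.getElem?_eq_getElem h1]
    rcases hlet V[m] with h | h
    · rw [h] at h2; exact absurd h2 hfe
    · rw [h]
  have hget : ∀ k < m, V[j + k]? = (e :: x)[k]? := by
    intro k hk
    rw [← hjs, window, List.getElem?_take, List.getElem?_drop, if_pos hk]
  rcases le_or_gt j m with hjm | hjm
  · have hVj := hget 0 (by omega)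
    rcases hjm.eq_or_lt with hjm | hjm
    · rw [hjm] at hVj
      simp only [Nat.add_zero, List.getElem?_cons_zero] at hVj
      rw [hVm] at hVj
      exact hef (Option.some_injective _ hVj).symm
    · have h1 : V[j]? = x[j - 1]? := by
        obtain ⟨i, hi⟩ := Nat.exists_eq_succ_of_ne_zero hj0
        rw [hi] at hjm ⊢
        simp only [hV, List.cons_append, List.getElem?_cons_succ, Nat.succ_sub_one]
        rw [List.append_assoc, List.getElem?_append_left (by omega)]
      have h2 := hget (m - j) (by omega)
      rw [show j + (m - j) = m by omega, hVm, show m - j = (m - j - 1) + 1 by omega,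
        List.getElem?_cons_succ] at h2
      -- `V[j] = e` is read in the first copy of `x` and `V[m] = f` in the second; the two positions
      -- in `x` are mirror images.
      have h3 : x[j - 1]? = x[m - j - 1]? := by
        conv_lhs => rw [← hpal]
        rw [List.getElem?_reverse (by omega)]
        congr 1
        omega
      simp only [Nat.add_zero, List.getElem?_cons_zero] at hVj
      rw [← h3, ← h1, hVj] at h2
      exact hef (Option.some_injective _ h2).symm
  -- The m + 1 windows at positions 0, ..., m avoid `e :: x`, which leaves at most m values for
  -- them.
  · have hcard := ncard_length_le hB hU m
    have hfin : {w | w ∈ B ∧ w.length = m}.Finite :=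
      (List.finite_length_eq Bool m).subset fun w hw => hw.2
    have hmem : e :: x ∈ {w | w ∈ B ∧ w.length = m} := ⟨hB ⟨[], [e], by simp⟩ he, by simp [hm]⟩
    have hlt : ({w | w ∈ B ∧ w.length = m} \ {e :: x}).ncard < (Finset.range (m + 1)).card := by
      have := Set.ncard_sdiff_singleton_add_one hmem hfin
      simp only [Finset.card_range]
      omega
    rw [Set.ncard_eq_toFinset_card _ hfin.sdiff] at hlt
    obtain ⟨i, hi, i', hi', hne, heq⟩ := Finset.exists_ne_map_eq_of_card_lt_of_maps_to hlt
      (f := window V m) (fun i hi => by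
        have hi : i < m + 1 := by simpa using hi
        simpa using ⟨⟨hwB m i, hwlen m i (by omega)⟩, hjlt i (by omega)⟩)
    have hi : i < m + 1 := by simpa using hi
    have hi' : i' < m + 1 := by simpa using hi'
    have main : ∀ i i', i < i' → i' < m + 1 → window V m i = window V m i' → False := by
      intro i i' hlt hi' heq
      have : ∀ t, i' + t ≤ j → window V m (i + t) = window V m (i' + t) := by
        intro t
        induction t with
        | zero => exact fun _ => heq
        | succ t ih => exact fun ht => hstep (i + t) (i' + t) (by omega) (by omega) (ih (by omega))
      have := this (j - i') (by omega)
      rw [show i' + (j - i') = j by omega, hjs] at this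
      exact hjlt _ (by omega) this
    rcases lt_or_gt_of_ne hne with h | h
    · exact main i i' h hi' heq
    · exact main i' i h hi heq.symm

/-- Binary words of the same length have almost equally many letters `true`. -/
def IsBalanced (B : Set (List Bool)) : Prop :=
  ∀ v ∈ B, ∀ w ∈ B, v.length = w.length → v.count true ≤ w.count true + 1

/-- A shortest unbalanced pair is `1x1`, `0x0`. Comparing prefixes and suffixes of the two words,
cut at equal or mirrored places, shows that the middle parts agree and form a palindrome. If both
`0x1` and `1x0` occur, then `0x` and `1x` are both right special; otherwise
`not_palindrome_bispecial` applies. -/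
theorem isBalanced_of_right_special_unique
    (hB : ∀ {v w : List Bool}, v <:+: w → w ∈ B → v ∈ B)
    (hirr : ∀ v ∈ B, ∀ w ∈ B, ∃ z, v ++ z ++ w ∈ B)
    (hU : ∀ x y : List Bool, x.length = y.length → x ++ [true] ∈ B → x ++ [false] ∈ B →
      y ++ [true] ∈ B → y ++ [false] ∈ B → x = y) : IsBalanced B := by
  classical
  by_contra hcon
  have hex : ∃ n : ℕ, ∃ v ∈ B, ∃ w ∈ B, v.length = n ∧ w.length = n ∧
      w.count true + 1 < v.count true := by
    simp only [IsBalanced] at hcon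
    push Not at hcon
    obtain ⟨v, hv, w, hw, hl, h⟩ := hcon
    exact ⟨_, v, hv, w, hw, rfl, hl.symm, h⟩
  obtain ⟨v, hv, w, hw, hvn, hwn, hlt⟩ := Nat.find_spec hex
  have hmin : ∀ v ∈ B, ∀ w ∈ B, v.length = w.length → v.length < Nat.find hex →
      v.count true ≤ w.count true + 1 := by
    intro v hv w hw hl hlt
    have := Nat.find_min hex hlt
    push Not at this
    exact this v hv w hw rfl hl.symm
  generalize Nat.find hex = n at *
  cases v with
  | nil => simp at hlt
  | cons a v =>
  cases w with
  | nil => simp at hwn hvn; omega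
  | cons b w =>
  rcases List.eq_nil_or_concat v with rfl | ⟨x, a', rfl⟩
  · cases a <;> simp [List.count_cons] at hlt
  rcases List.eq_nil_or_concat w with rfl | ⟨y, b', rfl⟩
  · simp at hwn hvn; omega
  simp only [List.concat_eq_append] at *
  have hxn : x.length + 2 = n := by simpa using hvn
  have hyn : y.length + 2 = n := by simpa using hwn
  have h1 := hmin (x ++ [a']) (hB ⟨[a], [], by simp⟩ hv) (y ++ [b']) (hB ⟨[b], [], by simp⟩ hw)
    (by simp; omega) (by simp; omega)
  have h2 := hmin (a :: x) (hB ⟨[], [a'], by simp⟩ hv) (b :: y) (hB ⟨[], [b'], by simp⟩ hw)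
    (by simp; omega) (by simp; omega)
  have hfour : a = true ∧ b = false ∧ a' = true ∧ b' = false ∧ x.count true = y.count true := by
    simp only [List.count_cons, List.count_append, List.count_nil] at h1 h2 hlt
    cases a <;> cases b <;> cases a' <;> cases b' <;> simp at h1 h2 hlt ⊢ <;> omega
  obtain ⟨rfl, rfl, rfl, rfl, hxy⟩ := hfour
  have hcons : ∀ p q : List Bool, true :: p ∈ B → false :: q ∈ B → p.length = q.length →
      p.length + 1 < n → p.count true ≤ q.count true := by
    intro p q hp hq hl hn
    simpa [List.count_cons] using hmin _ hp _ hq (by simpa using hl) (by simpa using hn)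
  have hsnoc : ∀ p q : List Bool, p ++ [true] ∈ B → q ++ [false] ∈ B → p.length = q.length →
      p.length + 1 < n → p.count true ≤ q.count true := by
    intro p q hp hq hl hn
    simpa [List.count_cons] using hmin _ hp _ hq (by simpa using hl) (by simpa using hn)
  have hmix : ∀ p q : List Bool, true :: p ∈ B → q ++ [false] ∈ B → p.length = q.length →
      p.length + 1 < n → p.count true ≤ q.count true := by
    intro p q hp hq hl hn
    simpa [List.count_cons] using hmin _ hp _ hq (by simpa using hl) (by simpa using hn)
  have hmix' : ∀ p q : List Bool, p ++ [true] ∈ B → false :: q ∈ B → p.length = q.length →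
      p.length + 1 < n → p.count true ≤ q.count true := by
    intro p q hp hq hl hn
    simpa [List.count_cons] using hmin _ hp _ hq (by simpa using hl) (by simpa using hn)
  have pre : ∀ (c c' : Bool) (x : List Bool) (k : ℕ), c :: (x ++ [c']) ∈ B → c :: x.take k ∈ B :=
    fun c c' x k h => hB ⟨[], x.drop k ++ [c'], by simp [← List.append_assoc]⟩ h
  have suf : ∀ (c c' : Bool) (x : List Bool) (k : ℕ), c :: (x ++ [c']) ∈ B →
      x.drop k ++ [c'] ∈ B :=
    fun c c' x k h => hB ⟨c :: x.take k, [], by simp [← List.append_assoc]⟩ h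
  have hsplit : ∀ (x : List Bool) (k : ℕ),
      x.count true = (x.take k).count true + (x.drop k).count true := fun x k => by
    rw [← List.count_append, List.take_append_drop]
  obtain rfl : x = y := by
    refine eq_of_count_take x y (by omega) fun k => ?_
    have h3 := hcons _ _ (pre _ _ _ k hv) (pre _ _ _ k hw) (by simp; omega) (by simp; omega)
    have h4 := hsnoc _ _ (suf _ _ _ k hv) (suf _ _ _ k hw) (by simp; omega) (by simp; omega)
    have := hsplit x k
    have := hsplit y k
    omega
  have hpal : x.reverse = x := by
    refine eq_of_count_take _ _ (by simp) fun k => ?_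
    rw [List.take_reverse, List.count_reverse]
    rcases le_total k x.length with hk | hk
    · have h3 := hmix _ _ (pre _ _ _ k hv) (suf _ _ _ (x.length - k) hw) (by simp; omega)
        (by simp; omega)
      have h4 := hmix' _ _ (suf _ _ _ (x.length - k) hv) (pre _ _ _ k hw) (by simp; omega)
        (by simp; omega)
      omega
    · rw [Nat.sub_eq_zero_of_le hk, List.drop_zero, List.take_of_length_le hk]
  by_cases h01 : false :: x ++ [true] ∈ B
  · by_cases h10 : true :: x ++ [false] ∈ B
    · have := hU (false :: x) (true :: x) (by simp) h01 hw hv h10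
      simp at this
    · exact not_palindrome_bispecial hB hirr hU hpal (e := false) (f := true) (by simp) hw hv h10
  · exact not_palindrome_bispecial hB hirr hU hpal (e := true) (f := false) (by simp) hv hw h01

/-- Suffixes of right special words are right special, and `0z`, `1z` cannot both be so, since `0z0`
and `1z1` would violate balance. -/
theorem IsBalanced.right_special_unique (hbal : IsBalanced B)
    (hB : ∀ {v w : List Bool}, v <:+: w → w ∈ B → v ∈ B) :
    ∀ x y : List Bool, x.length = y.length → x ++ [true] ∈ B → x ++ [false] ∈ B →
      y ++ [true] ∈ B → y ++ [false] ∈ B → x = y := by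
  intro x
  induction x with
  | nil =>
    intro y hy _ _ _ _
    exact (List.length_eq_zero_iff.1 hy.symm).symm
  | cons a x ih =>
    intro y hy h1 h0 h1' h0'
    cases y with
    | nil => simp at hy
    | cons b y =>
    obtain rfl : x = y := ih y (by simpa using hy) (hB ⟨[a], [], by simp⟩ h1)
      (hB ⟨[a], [], by simp⟩ h0) (hB ⟨[b], [], by simp⟩ h1') (hB ⟨[b], [], by simp⟩ h0')
    have h3 := hbal _ h1 _ h0' (by simp)
    have h4 := hbal _ h1' _ h0 (by simp)
    cases a <;> cases b <;> simp at h3 h4 ⊢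

/-- A balanced extension of a language with right special words of all lengths is trivial. -/
theorem subset_of_balanced_union {B' : Set (List Bool)}
    (hB : ∀ {v w : List Bool}, v <:+: w → w ∈ B → v ∈ B)
    (hB' : ∀ {v w : List Bool}, v <:+: w → w ∈ B' → v ∈ B')
    (hext : ∀ x ∈ B, ∃ a, x ++ [a] ∈ B)
    (hsp : ∀ n : ℕ, ∃ x : List Bool, x.length = n ∧ x ++ [true] ∈ B ∧ x ++ [false] ∈ B)
    (hbal : IsBalanced (B ∪ B')) : B' ⊆ B := by
  have hU := hbal.right_special_unique (fun {v w} hvw hw => hw.imp (hB hvw) (hB' hvw))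
  intro w
  induction w using List.reverseRecOn with
  | nil =>
    intro _
    obtain ⟨x, -, hx, -⟩ := hsp 0
    exact hB List.nil_infix hx
  | append_singleton w a ih =>
    intro hwa
    obtain ⟨b, hb⟩ := hext w (ih (hB' (List.prefix_append _ _).isInfix hwa))
    by_cases hab : a = b
    · exact hab ▸ hb
    -- Two different continuations make `w` right special in the union, so it is the right special
    -- word of `B`, both of whose continuations lie in `B`.
    obtain ⟨x, hx, h1, h0⟩ := hsp w.length
    have : w = x := by
      cases a <;> cases b <;> simp at hab
      · exact hU w x hx.symm (.inl hb) (.inr hwa) (.inl h1) (.inl h0)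
      · exact hU w x hx.symm (.inr hwa) (.inl hb) (.inl h1) (.inl h0)
    subst this
    cases a
    exacts [h0, h1]

end Binary

end InfWord

/-! ### The letter graph, and coding its paths by binary words. -/

namespace InfWord

variable {α : Type*} {L : Set (List α)}

theorem drop_append_infix (n : ℕ) (v w : List α) : v.drop n ++ w <:+: v ++ w :=
  ⟨v.take n, [], by rw [← List.append_assoc, List.take_append_drop, List.append_nil]⟩

theorem isChain_of_mem (hL : ∀ {v w : List α}, v <:+: w → w ∈ L → v ∈ L) :
    ∀ w ∈ L, w.IsChain fun p q => [p, q] ∈ L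
  | [], _ => by simp
  | [a], _ => by simp
  | a :: b :: w, h => by
    rw [List.isChain_cons_cons]
    exact ⟨hL ⟨[], w, by simp⟩ h, isChain_of_mem hL (b :: w) (hL ⟨[a], [], by simp⟩ h)⟩

theorem forall_mem_of_isChain {R : α → α → Prop} {S : α → Prop}
    (hS : ∀ p q, S p → R p q → S q) : ∀ (w : List α) (p : α), (p :: w).IsChain R → S p →
      ∀ q ∈ w, S q
  | [], _, _, _ => by simp
  | b :: w, p, h, hp => by
    rw [List.isChain_cons_cons] at h
    have hb := hS p b hp h.1
    intro q hq
    rcases List.mem_cons.1 hq with rfl | hq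
    · exact hb
    · exact forall_mem_of_isChain hS w b h.2 hb q hq

theorem IsQuasiSturmianLang.forall_of_succ_closed (h : IsQuasiSturmianLang L) {S : α → Prop}
    (hS : ∀ p q, S p → [p, q] ∈ L → S q) {p : α} (hpL : [p] ∈ L) (hp : S p) {q : α}
    (hq : [q] ∈ L) : S q := by
  obtain ⟨z, hz⟩ := h.irreducible _ hpL _ hq
  exact forall_mem_of_isChain hS (z ++ [q]) p
    (by simpa using isChain_of_mem h.mem_of_infix _ hz) hp q (by simp)

theorem IsQuasiSturmianLang.forall_of_pred_closed (h : IsQuasiSturmianLang L) {S : α → Prop}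
    (hS : ∀ p q, S q → [p, q] ∈ L → S p) {p : α} (hpL : [p] ∈ L) (hp : S p) {q : α}
    (hq : [q] ∈ L) : S q :=
  h.reverse.forall_of_succ_closed (fun p q hp hpq => hS q p hp (by simpa [revLang] using hpq))
    (by simpa [revLang] using hpL) hp (by simpa [revLang] using hq)

theorem IsQuasiSturmianLang.fst_mem (h : IsQuasiSturmianLang L) {p q : α} (hpq : [p, q] ∈ L) :
    [p] ∈ L := h.mem_of_infix ⟨[], [q], by simp⟩ hpq

theorem IsQuasiSturmianLang.snd_mem (h : IsQuasiSturmianLang L) {p q : α} (hpq : [p, q] ∈ L) :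
    [q] ∈ L := h.mem_of_infix ⟨[p], [], by simp⟩ hpq

/-- `r` is the right special letter of `L`, and `c` and `d` are the letters that follow it. -/
structure IsRightSpecial (L : Set (List α)) (r c d : α) : Prop where
  ne : c ≠ d
  mem_left : [r, c] ∈ L
  mem_right : [r, d] ∈ L
  eq_or_eq : ∀ q, [r, q] ∈ L → q = c ∨ q = d
  eq_of_ne : ∀ p q q', [p, q] ∈ L → [p, q'] ∈ L → q ≠ q' → p = r

theorem IsRightSpecial.symm {r c d : α} (h : IsRightSpecial L r c d) : IsRightSpecial L r d c :=
  ⟨h.ne.symm, h.mem_right, h.mem_left, fun q hq => (h.eq_or_eq q hq).symm, h.eq_of_ne⟩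

theorem IsRightSpecial.succ_unique {r c d : α} (h : IsRightSpecial L r c d) {p q q' : α}
    (hp : p ≠ r) (h1 : [p, q] ∈ L) (h2 : [p, q'] ∈ L) : q = q' := by
  by_contra hne
  exact hp (h.eq_of_ne p q q' h1 h2 hne)

theorem IsQuasiSturmianLang.exists_isRightSpecial (h : IsQuasiSturmianLang L) :
    ∃ r c d, IsRightSpecial L r c d := by
  obtain ⟨x, c, d, hx, hcd, hc, hd⟩ := h.exists_right 1 one_ne_zero
  obtain ⟨r, rfl⟩ := List.length_eq_one_iff.1 hx
  refine ⟨r, c, d, hcd, hc, hd, fun q hq => ?_, fun p q q' h1 h2 hne => ?_⟩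
  · by_cases hqc : q = c
    · exact .inl hqc
    · exact (h.right_unique (x := [r]) (x' := [r]) (by simp) rfl hcd hqc hc hd hq hc).2
  · have := (h.right_unique (x := [r]) (x' := [p]) (by simp) rfl hcd hne hc hd h1 h2).1
    simpa using this.symm

/-- One of the two successors of `r` is not the left special letter; it serves as `d`. If it were
`r`, the set {r} would be closed under predecessors. -/
theorem IsQuasiSturmianLang.exists_letters (h : IsQuasiSturmianLang L) :
    ∃ r c d, IsRightSpecial L r c d ∧ (∀ p, [p, d] ∈ L → p = r) ∧ d ≠ r := by
  obtain ⟨l, a, b, hl⟩ := h.reverse.exists_isRightSpecial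
  have key : ∀ r c d, IsRightSpecial L r c d → d ≠ l →
      (∀ p, [p, d] ∈ L → p = r) ∧ d ≠ r := by
    intro r c d hr hdl
    have h1 : ∀ p, [p, d] ∈ L → p = r := fun p hp => hl.succ_unique hdl
      (by simpa [revLang] using hp) (by simpa [revLang] using hr.mem_right)
    refine ⟨h1, ?_⟩
    rintro rfl
    obtain ⟨e, he, hed, -, -⟩ := h.exists_fourth d d d
    refine hed (h.forall_of_pred_closed (S := fun q => q = d) ?_ (h.snd_mem hr.mem_right) rfl he)
    rintro p q rfl hpq
    exact h1 p hpq
  obtain ⟨r, c, d, hr⟩ := h.exists_isRightSpecial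
  by_cases hdl : d = l
  · exact ⟨r, d, c, hr.symm, key r d c hr.symm (by rintro rfl; exact hr.ne hdl.symm)⟩
  · exact ⟨r, c, d, hr, key r c d hr hdl⟩

theorem exists_append_mem {M : Set (List α)} (hright : ∀ x ∈ M, ∃ a, x ++ [a] ∈ M) (n : ℕ) :
    ∀ x ∈ M, ∃ t : List α, t.length = n ∧ x ++ t ∈ M := by
  induction n with
  | zero => exact fun x hx => ⟨[], rfl, by simpa using hx⟩
  | succ n ih =>
    intro x hx
    obtain ⟨t, ht, hxt⟩ := ih x hx
    obtain ⟨a, ha⟩ := hright _ hxt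
    exact ⟨t ++ [a], by simp [ht], by simpa using ha⟩

theorem exists_prepend_mem {M : Set (List α)} (hleft : ∀ x ∈ M, ∃ a, a :: x ∈ M) (n : ℕ) :
    ∀ x ∈ M, ∃ t : List α, t.length = n ∧ t ++ x ∈ M := by
  induction n with
  | zero => exact fun x hx => ⟨[], rfl, by simpa using hx⟩
  | succ n ih =>
    intro x hx
    obtain ⟨t, ht, hxt⟩ := ih x hx
    obtain ⟨a, ha⟩ := hleft _ hxt
    exact ⟨a :: t, by simp [ht], by simpa using ha⟩

section Code

variable [DecidableEq α]

/-- The binary code of a word: `true` for `d`, `false` for `r`, other letters are erased. -/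
def code (r d : α) (w : List α) : List Bool :=
  w.filterMap fun a => if a = d then some true else if a = r then some false else none

variable {r c d : α}

theorem code_append (v w : List α) : code r d (v ++ w) = code r d v ++ code r d w :=
  List.filterMap_append

@[simp] theorem code_nil : code r d ([] : List α) = [] := rfl

theorem code_cons_right (w : List α) : code r d (d :: w) = true :: code r d w := by simp [code]

theorem code_cons_left (h : d ≠ r) (w : List α) : code r d (r :: w) = false :: code r d w := by
  simp [code, h.symm]

theorem code_cons_of_ne {a : α} (hd : a ≠ d) (hr : a ≠ r) (w : List α) :
    code r d (a :: w) = code r d w := by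
  simp [code, hd, hr]

theorem count_true_code (w : List α) : (code r d w).count true = w.count d := by
  induction w with
  | nil => rfl
  | cons a w ih =>
    by_cases hd : a = d
    · subst hd; simp [code_cons_right, ih]
    · by_cases hr : a = r
      · subst hr; rw [code_cons_left (Ne.symm hd)]; simp [ih, hd]
      · rw [code_cons_of_ne hd hr]; simp [ih, hd]

theorem length_code (h : d ≠ r) (w : List α) :
    (code r d w).length = w.count d + w.count r := by
  induction w with
  | nil => rfl
  | cons a w ih =>
    by_cases hd : a = d
    · subst hd; simp [code_cons_right, ih, h]; omega
    · by_cases hr : a = r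
      · subst hr; rw [code_cons_left (Ne.symm hd)]; simp [ih, hd]; omega
      · rw [code_cons_of_ne hd hr]; simp [ih, hd, hr]

theorem notMem_of_code_eq_nil (h : d ≠ r) {w : List α} (hw : code r d w = []) :
    r ∉ w ∧ d ∉ w := by
  have := length_code h w
  rw [hw, List.length_nil] at this
  rw [← List.count_eq_zero, ← List.count_eq_zero]
  omega

theorem code_eq_append {w : List α} {s t : List Bool} (h : code r d w = s ++ t) :
    ∃ w₁ w₂, w = w₁ ++ w₂ ∧ code r d w₁ = s ∧ code r d w₂ = t :=
  List.filterMap_eq_append_iff.1 h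

theorem code_eq_cons {w : List α} {e : Bool} {t : List Bool}
    (hw : code r d w = e :: t) :
    ∃ w₁ w₂, w = w₁ ++ (if e then d else r) :: w₂ ∧ code r d w₁ = [] ∧ code r d w₂ = t := by
  obtain ⟨w₁, a, w₂, h1, h2, h3, h4⟩ := List.filterMap_eq_cons_iff.1 hw
  refine ⟨w₁, w₂, ?_, List.filterMap_eq_nil_iff.2 h2, h4⟩
  rw [h1]
  congr 2
  split_ifs at h3 with h5 h6
  · simp at h3; simp [← h3, h5]
  · simp at h3; simp [← h3, h6]

/-- Every `d` comes directly after an `r`, so beyond a letter other than `r` the first coded letter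
can only be `r`. -/
theorem code_ne_true_cons (hd : ∀ p, [p, d] ∈ L → p = r) (hdr : d ≠ r) :
    ∀ (w : List α) (p : α) (t : List Bool), (p :: w).IsChain (fun p q => [p, q] ∈ L) → p ≠ r →
      code r d w ≠ true :: t
  | [], _, _, _, _ => by simp
  | b :: w, p, t, h, hp => by
    rw [List.isChain_cons_cons] at h
    by_cases hbd : b = d
    · exact absurd (hd p (hbd ▸ h.1)) hp
    by_cases hbr : b = r
    · subst hbr; rw [code_cons_left hdr]; simp
    · rw [code_cons_of_ne hbd hbr]
      exact code_ne_true_cons hd hdr w b t h.2 hbr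

theorem code_cons_ne_true_cons (hd : ∀ p, [p, d] ∈ L → p = r) (hdr : d ≠ r) (w : List α) (p : α)
    (t : List Bool) (h : (p :: w).IsChain (fun p q => [p, q] ∈ L)) (hp : p ≠ d) :
    code r d (p :: w) ≠ true :: t := by
  by_cases hpr : p = r
  · subst hpr; rw [code_cons_left hdr]; simp
  · rw [code_cons_of_ne hp hpr]
    exact code_ne_true_cons hd hdr w p t h hpr

/-- A path is determined by its first letter and its code. -/
theorem prefix_or_prefix_of_code_eq (hr : IsRightSpecial L r c d)
    (hd : ∀ p, [p, d] ∈ L → p = r) (hdr : d ≠ r) :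
    ∀ (v w : List α) (a : α), (a :: v).IsChain (fun p q => [p, q] ∈ L) →
      (a :: w).IsChain (fun p q => [p, q] ∈ L) → code r d v = code r d w → v <+: w ∨ w <+: v
  | [], _, _, _, _, _ => .inl List.nil_prefix
  | _ :: _, [], _, _, _, _ => .inr List.nil_prefix
  | b :: v, b' :: w, a, hv, hw, h => by
    rw [List.isChain_cons_cons] at hv hw
    -- Paths diverge only at `r`, one to `d` and the other to `c`. The code then goes on with `true`
    -- for the first and cannot for the second. Trailing erased letters leave no trace, hence
    -- prefixes instead of equality.
    have hb : b = b' := by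
      by_contra hne
      obtain rfl := hr.eq_of_ne _ _ _ hv.1 hw.1 hne
      rcases eq_or_ne b d with rfl | hbd
      · exact code_cons_ne_true_cons hd hdr w b' _ hw.2 (Ne.symm hne)
          (h.symm.trans (code_cons_right v))
      rcases eq_or_ne b' d with rfl | hbd'
      · exact code_cons_ne_true_cons hd hdr v b _ hv.2 hne (h.trans (code_cons_right w))
      rcases hr.eq_or_eq b hv.1 with h1 | h1
      · rcases hr.eq_or_eq b' hw.1 with h2 | h2
        · exact hne (h1.trans h2.symm)
        · exact hbd' h2
      · exact hbd h1
    subst hb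
    have : code r d v = code r d w := by
      have e : ∀ u : List α, b :: u = [b] ++ u := fun _ => rfl
      rw [e v, e w, code_append, code_append] at h
      exact List.append_cancel_left h
    rcases prefix_or_prefix_of_code_eq hr hd hdr v w b hv.2 hw.2 this with h | h
    · exact .inl (List.cons_prefix_cons.2 ⟨rfl, h⟩)
    · exact .inr (List.cons_prefix_cons.2 ⟨rfl, h⟩)

theorem code_infix {M : Set (List α)} (hM : ∀ {v w : List α}, v <:+: w → w ∈ M → v ∈ M)
    {v w : List Bool} (hvw : v <:+: w) (hw : w ∈ code r d '' M) : v ∈ code r d '' M := by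
  obtain ⟨s, t, rfl⟩ := hvw
  obtain ⟨u, hu, hut⟩ := hw
  obtain ⟨u₁, u₂, rfl, h1, -⟩ := code_eq_append hut
  obtain ⟨u₃, u₄, rfl, -, h2⟩ := code_eq_append h1
  exact ⟨u₄, hM ⟨u₃, u₂, by simp⟩ hu, h2⟩

/-- The two occurrences of `x` decode to paths with the same first letter and code, so they agree up
to trailing erased letters. The path continued by `d` stops at `r`, and from there the other one
must go on to `c`. -/
theorem IsQuasiSturmianLang.exists_lift (h : IsQuasiSturmianLang L) (hr : IsRightSpecial L r c d)
    (hd : ∀ p, [p, d] ∈ L → p = r) (hdr : d ≠ r) {x : List Bool} (hx : x ≠ [])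
    (h1 : x ++ [true] ∈ code r d '' L) (h0 : x ++ [false] ∈ code r d '' L) :
    ∃ w, w ≠ [] ∧ code r d w = x ∧ w ++ [d] ∈ L ∧ w ++ [c] ∈ L := by
  obtain ⟨e, x, rfl⟩ := List.exists_cons_of_ne_nil hx
  have lift : ∀ b : Bool, e :: x ++ [b] ∈ code r d '' L → ∃ v, code r d v = x ∧
      (if e then d else r) :: v ++ [if b then d else r] ∈ L := by
    rintro b ⟨u, hu, hub⟩
    obtain ⟨u₁, u₂, rfl, hu1, hu2⟩ := code_eq_cons hub
    obtain ⟨u₃, u₄, rfl, hu3, hu4⟩ := code_eq_append hu2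
    obtain ⟨u₅, u₆, rfl, hu5, hu6⟩ := code_eq_cons hu4
    exact ⟨u₃ ++ u₅, by simp [code_append, hu3, hu5], h.mem_of_infix ⟨u₁, u₆, by simp⟩ hu⟩
  obtain ⟨w, hwx, hw⟩ := lift true h1
  obtain ⟨v, hvx, hv⟩ := lift false h0
  simp only [if_true, Bool.false_eq_true, if_false] at hw hv
  generalize ha : (if e = true then d else r) = a at hw hv
  have hcode : code r d (a :: w) = e :: x := by
    rw [← ha]
    cases e
    · simp [code_cons_left hdr, hwx]
    · simp [code_cons_right, hwx]
  refine ⟨a :: w, by simp, hcode, hw, ?_⟩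
  obtain ⟨w', z, hz⟩ : ∃ w' z, a :: w = w' ++ [z] :=
    ⟨_, _, (List.dropLast_append_getLast (List.cons_ne_nil a w)).symm⟩
  obtain rfl : z = r := hd z (h.mem_of_infix ⟨w', [], by simp⟩ (hz ▸ hw))
  have hnext : ∀ b, b ≠ d → a :: w ++ [b] ∈ L → a :: w ++ [c] ∈ L := by
    intro b hbd hb
    have : [z, b] ∈ L := h.mem_of_infix ⟨w', [], by simp⟩ (hz ▸ hb)
    rcases hr.eq_or_eq b this with rfl | rfl
    · exact hb
    · exact absurd rfl hbd
  have hch := isChain_of_mem h.mem_of_infix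
  rcases prefix_or_prefix_of_code_eq hr hd hdr w v a
    (hch _ (h.mem_of_infix (List.prefix_append _ _).isInfix hw))
    (hch _ (h.mem_of_infix (List.prefix_append _ _).isInfix hv)) (hwx.trans hvx.symm)
    with ⟨t, rfl⟩ | ⟨t, rfl⟩
  · have ht : code z d t = [] := by
      rw [code_append, hwx] at hvx
      simpa using hvx
    have htd := (notMem_of_code_eq_nil hdr ht).2
    cases t with
    | nil => exact hnext z hdr.symm (by simpa using hv)
    | cons b t =>
      exact hnext b (by rintro rfl; simp at htd) (h.mem_of_infix ⟨[], t ++ [z], by simp⟩ hv)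
  · have ht : code z d t = [] := by
      rw [code_append, hvx] at hwx
      simpa using hwx
    rcases List.eq_nil_or_concat t with rfl | ⟨t, b, rfl⟩
    · exact hnext z hdr.symm (by simpa using hv)
    · have hb : b = z := by
        have : (a :: v ++ t) ++ [b] = w' ++ [z] := by rw [← hz]; simp
        simpa using (List.append_inj' this rfl).2
      exact absurd (notMem_of_code_eq_nil hdr ht).1 (by simp [hb])

/-- Of two right special words of `L` the shorter is a suffix of the longer, and this passes to
their codes. -/
theorem IsQuasiSturmianLang.code_right_unique (h : IsQuasiSturmianLang L)
    (hr : IsRightSpecial L r c d) (hd : ∀ p, [p, d] ∈ L → p = r) (hdr : d ≠ r)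
    (x y : List Bool) (hxy : x.length = y.length) (h1 : x ++ [true] ∈ code r d '' L)
    (h0 : x ++ [false] ∈ code r d '' L) (h1' : y ++ [true] ∈ code r d '' L)
    (h0' : y ++ [false] ∈ code r d '' L) : x = y := by
  rcases eq_or_ne x [] with rfl | hx
  · exact (List.length_eq_zero_iff.1 hxy.symm).symm
  have hy : y ≠ [] := by
    rintro rfl
    exact hx (List.length_eq_zero_iff.1 hxy)
  obtain ⟨v, hv, rfl, hvd, hvc⟩ := h.exists_lift hr hd hdr hx h1 h0
  obtain ⟨w, hw, rfl, hwd, hwc⟩ := h.exists_lift hr hd hdr hy h1' h0'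
  have main : ∀ v w : List α, v ≠ [] → v ++ [d] ∈ L → v ++ [c] ∈ L → w ++ [d] ∈ L →
      w ++ [c] ∈ L → v.length ≤ w.length → (code r d v).length = (code r d w).length →
      code r d v = code r d w := by
    intro v w hv hvd hvc hwd hwc hle hlen
    have hvw : v = w.drop (w.length - v.length) := by
      refine (h.right_unique hv (by simp; omega) hr.ne.symm hr.ne.symm hvd hvc ?_ ?_).1
      · exact h.mem_of_infix (drop_append_infix _ _ _) hwd
      · exact h.mem_of_infix (drop_append_infix _ _ _) hwc
    have hsplit : code r d w = code r d (w.take (w.length - v.length)) ++ code r d v := by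
      conv_lhs => rw [← List.take_append_drop (w.length - v.length) w, code_append, ← hvw]
    have : code r d (w.take (w.length - v.length)) = [] := by
      rw [hsplit, List.length_append] at hlen
      exact List.length_eq_zero_iff.1 (by omega)
    rw [hsplit, this, List.nil_append]
  rcases le_total v.length w.length with hle | hle
  · exact main v w hv hvd hvc hwd hwc hle hxy
  · exact (main w v hw hwd hwc hvd hvc hle hxy.symm).symm

theorem IsQuasiSturmianLang.code_irreducible (h : IsQuasiSturmianLang L) (v : List Bool)
    (hv : v ∈ code r d '' L) (w : List Bool) (hw : w ∈ code r d '' L) :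
    ∃ z, v ++ z ++ w ∈ code r d '' L := by
  obtain ⟨v, hv, rfl⟩ := hv
  obtain ⟨w, hw, rfl⟩ := hw
  obtain ⟨z, hz⟩ := h.irreducible v hv w hw
  exact ⟨code r d z, _, hz, by simp [code_append]⟩

theorem IsQuasiSturmianLang.exists_le_length_code (h : IsQuasiSturmianLang L) (hdr : d ≠ r)
    (hrL : [r] ∈ L) (n : ℕ) : ∃ N : ℕ, ∀ w ∈ L, N ≤ w.length → n ≤ (code r d w).length := by
  obtain ⟨M, hM⟩ := h.exists_infix_of_length_le hrL
  induction n with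
  | zero => exact ⟨0, fun _ _ _ => Nat.zero_le _⟩
  | succ n ih =>
    obtain ⟨N, hN⟩ := ih
    refine ⟨N + M, fun w hw hlen => ?_⟩
    have h1 := hN (w.take N) (h.mem_of_infix (List.take_prefix _ _).isInfix hw) (by simp; omega)
    have h2 := hM (w.drop N) (h.mem_of_infix (List.drop_suffix _ _).isInfix hw) (by simp; omega)
    have h3 : 0 < (w.drop N).count r :=
      List.count_pos_iff.2 ((List.singleton_infix_iff _ _).1 h2)
    rw [← List.take_append_drop N w, code_append, List.length_append, length_code hdr (w.drop N)]
    omega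

/-- A long right special word of `L` ends in `r`. Continuing to `d` adds `true` to its code;
continuing to `c` and on to the next coded letter adds `false`. Cutting the code on the left gives
the exact length. -/
theorem IsQuasiSturmianLang.exists_code_right_special (h : IsQuasiSturmianLang L)
    (hr : IsRightSpecial L r c d) (hd : ∀ p, [p, d] ∈ L → p = r) (hdr : d ≠ r) (n : ℕ) :
    ∃ x : List Bool, x.length = n ∧ x ++ [true] ∈ code r d '' L ∧
      x ++ [false] ∈ code r d '' L := by
  have hrL : [r] ∈ L := h.fst_mem hr.mem_left
  obtain ⟨N, hN⟩ := h.exists_le_length_code (r := r) hdr hrL n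
  obtain ⟨x, a, b, hx, hab, ha, hb⟩ := h.exists_right (N + 1) (by simp)
  have hxL : x ∈ L := h.mem_of_infix (List.prefix_append _ _).isInfix ha
  have hlen := hN x hxL (by omega)
  obtain ⟨y, z, rfl⟩ : ∃ y z, x = y ++ [z] := by
    rcases List.eq_nil_or_concat x with rfl | ⟨y, z, rfl⟩
    · simp at hx
    · exact ⟨y, z, by simp⟩
  have ha' : [z, a] ∈ L := h.mem_of_infix ⟨y, [], by simp⟩ ha
  have hb' : [z, b] ∈ L := h.mem_of_infix ⟨y, [], by simp⟩ hb
  obtain rfl := hr.eq_of_ne _ _ _ ha' hb' hab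
  obtain ⟨hc, hd'⟩ : y ++ [z] ++ [c] ∈ L ∧ y ++ [z] ++ [d] ∈ L := by
    rcases hr.eq_or_eq a ha' with rfl | rfl <;> rcases hr.eq_or_eq b hb' with rfl | rfl
    exacts [absurd rfl hab, ⟨ha, hb⟩, ⟨hb, ha⟩, absurd rfl hab]
  refine ⟨(code z d (y ++ [z])).drop ((code z d (y ++ [z])).length - n), by simp; omega, ?_, ?_⟩
  · refine code_infix h.mem_of_infix (drop_append_infix _ _ _) ⟨_, hd', ?_⟩
    rw [code_append (y ++ [z]), code_cons_right, code_nil]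
  · obtain ⟨t, ht⟩ := h.irreducible _ hc _ hrL
    have hch : (c :: (t ++ [z])).IsChain fun p q => [p, q] ∈ L :=
      isChain_of_mem h.mem_of_infix _ (h.mem_of_infix ⟨y ++ [z], [], by simp⟩ ht)
    obtain ⟨s, hs⟩ : ∃ s, code z d (c :: (t ++ [z])) = false :: s := by
      cases hcode : code z d (c :: (t ++ [z])) with
      | nil => exact absurd (notMem_of_code_eq_nil hdr hcode).1 (by simp)
      | cons e s =>
        cases e
        · exact ⟨s, rfl⟩
        · exact absurd hcode (code_cons_ne_true_cons hd hdr _ _ _ hch hr.ne)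
    have hmem : code z d (y ++ [z]) ++ false :: s ∈ code z d '' L := by
      refine ⟨_, ht, ?_⟩
      rw [← hs, ← code_append]
      simp
    refine code_infix h.mem_of_infix ?_ hmem
    exact (drop_append_infix _ _ _).trans ⟨[], s, by simp⟩

theorem exists_perm_of_abelian {M : Set (List α)} (hab : ∀ v ∈ M, ∃ w ∈ L, AbelianEquiv v w)
    {v : List α} (hv : v ∈ M) : ∃ w ∈ L, w.Perm v := by
  obtain ⟨w, hw, hvw⟩ := hab v hv
  exact ⟨w, hw, (List.perm_iff_count.2 hvw).symm⟩

theorem IsQuasiSturmianLang.exists_mem_of_abelian (h : IsQuasiSturmianLang L) {M : Set (List α)}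
    (hab : ∀ v ∈ M, ∃ w ∈ L, AbelianEquiv v w) {a : α} (ha : [a] ∈ L) :
    ∃ N : ℕ, ∀ x ∈ M, N ≤ x.length → a ∈ x := by
  obtain ⟨N, hN⟩ := h.exists_infix_of_length_le ha
  refine ⟨N, fun x hx hlen => ?_⟩
  obtain ⟨w, hw, hwx⟩ := exists_perm_of_abelian hab hx
  exact hwx.mem_iff.1 ((List.singleton_infix_iff _ _).1 (hN w hw (by rwa [hwx.length_eq])))

/-- A language of paths that is abelian equivalent to words of `L` is contained in `L`. -/
theorem IsQuasiSturmianLang.subset_of_abelian (h : IsQuasiSturmianLang L) {M : Set (List α)}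
    (hM : ∀ {v w : List α}, v <:+: w → w ∈ M → v ∈ M)
    (hright : ∀ x ∈ M, ∃ a, x ++ [a] ∈ M) (hleft : ∀ x ∈ M, ∃ a, a :: x ∈ M)
    (hab : ∀ v ∈ M, ∃ w ∈ L, AbelianEquiv v w) (hpath : ∀ p q, [p, q] ∈ M → [p, q] ∈ L) :
    M ⊆ L := by
  obtain ⟨r, c, d, hr, hd, hdr⟩ := h.exists_letters
  have hrL : [r] ∈ L := h.fst_mem hr.mem_left
  -- The length of a code and its number of `true` depend only on the counts of `r` and `d`, so
  -- balance extends from the codes of `L` to those of `M`.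
  have hsub : code r d '' M ⊆ code r d '' L := by
    refine subset_of_balanced_union (code_infix h.mem_of_infix) (code_infix hM) ?_
      (h.exists_code_right_special hr hd hdr) ?_
    · intro x hx
      obtain ⟨z, hz⟩ := h.code_irreducible x hx [false] ⟨[r], hrL, by simp [code_cons_left hdr]⟩
      cases z with
      | nil => exact ⟨false, by simpa using hz⟩
      | cons a z => exact ⟨a, code_infix h.mem_of_infix ⟨[], z ++ [false], by simp⟩ hz⟩
    · have hbal := isBalanced_of_right_special_unique (code_infix (r := r) (d := d) h.mem_of_infix)
        h.code_irreducible (h.code_right_unique hr hd hdr)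
      have hrep : ∀ v ∈ code r d '' L ∪ code r d '' M, ∃ w ∈ code r d '' L,
          v.length = w.length ∧ v.count true = w.count true := by
        rintro v (hv | ⟨v, hv, rfl⟩)
        · exact ⟨v, hv, rfl, rfl⟩
        · obtain ⟨w, hw, hvw⟩ := hab v hv
          exact ⟨_, ⟨w, hw, rfl⟩, by rw [length_code hdr, length_code hdr, hvw d, hvw r],
            by rw [count_true_code, count_true_code, hvw d]⟩
      intro v hv w hw hvw
      obtain ⟨v', hv', h1, h2⟩ := hrep v hv
      obtain ⟨w', hw', h3, h4⟩ := hrep w hw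
      rw [h2, h4]
      exact hbal v' hv' w' hw' (by omega)
  -- Enlarge `w` within `M` to a word that starts and ends with `r`. The first `r` fixes where
  -- decoding starts; the last one rules out that the decoded path in `L` stops short.
  obtain ⟨N, hNM⟩ := h.exists_mem_of_abelian hab hrL
  intro w hw
  obtain ⟨p, hp, hpw⟩ := exists_prepend_mem hleft N w hw
  obtain ⟨q, hq, hpq⟩ := exists_append_mem hright N _ hpw
  obtain ⟨p₁, p₂, rfl⟩ := List.append_of_mem
    (hNM p (hM (List.prefix_append _ _).isInfix hpw) hp.ge)
  obtain ⟨q₁, q₂, rfl⟩ := List.append_of_mem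
    (hNM q (hM (List.suffix_append _ _).isInfix hpq) hq.ge)
  have hmem : r :: (p₂ ++ w ++ q₁ ++ [r]) ∈ M := hM ⟨p₁, q₂, by simp⟩ hpq
  set t := p₂ ++ w ++ q₁ with ht
  obtain ⟨u, hu, hcode⟩ := hsub ⟨_, hmem, rfl⟩
  rw [code_cons_left hdr] at hcode
  obtain ⟨u₁, u₂, rfl, -, hu2⟩ := code_eq_cons hcode
  have hu' : r :: u₂ ∈ L := h.mem_of_infix ⟨u₁, [], by simp⟩ hu
  have hch : (r :: (t ++ [r])).IsChain fun p q => [p, q] ∈ L :=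
    (isChain_of_mem hM _ hmem).imp hpath
  have hpre : t ++ [r] <+: u₂ := by
    rcases prefix_or_prefix_of_code_eq hr hd hdr _ _ r hch (isChain_of_mem h.mem_of_infix _ hu')
      hu2.symm with h1 | ⟨s, hs⟩
    · exact h1
    · rcases List.eq_nil_or_concat s with rfl | ⟨s, b, rfl⟩
      · exact ⟨[], by simpa using hs.symm⟩
      · have hs' : (u₂ ++ s) ++ [b] = t ++ [r] := by simpa using hs
        have hb : b = r := by simpa using (List.append_inj' hs' rfl).2
        have : code r d (s ++ [b]) = [] := by
          rw [← hs, code_append] at hu2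
          simpa using hu2
        exact absurd (notMem_of_code_eq_nil hdr this).1 (by simp [hb])
  refine h.mem_of_infix ?_ hu'
  have : w <:+: t ++ [r] := ⟨p₂, q₁ ++ [r], by simp [ht]⟩
  exact this.trans (hpre.isInfix.trans (List.suffix_cons _ _).isInfix)

end Code

end InfWord

/-! ### Walks in the abelian closure do not turn. A neutral pair is an edge usable both ways; a
loop, with `c = r`, is included. -/

namespace InfWord

variable {α : Type*} {L M : Set (List α)} {r c d : α}

theorem perm_pair_cases {v : List α} {a b : α} (h : v.Perm [a, b]) : v = [a, b] ∨ v = [b, a] := by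
  simpa [List.permutations'] using List.mem_permutations'.2 h

theorem perm_triple_cases {v : List α} {a b c : α} (h : v.Perm [a, b, c]) :
    v = [a, b, c] ∨ v = [b, a, c] ∨ v = [b, c, a] ∨ v = [a, c, b] ∨ v = [c, a, b] ∨
      v = [c, b, a] := by
  simpa [List.permutations', or_assoc] using List.mem_permutations'.2 h

theorem forall_mem_of_trapped (hL : ∀ {v w : List α}, v <:+: w → w ∈ L → v ∈ L)
    {S T : α → Prop} (hS : ∀ s, S s → ∀ t, T t → [s, t] ∈ L → S t) :
    ∀ (w : List α) (p : α), p :: w ∈ L → (∀ q ∈ w, T q) → S p → ∀ q ∈ p :: w, S q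
  | [], p, _, _, hp => by simpa using hp
  | b :: w, p, h, hT, hp => by
    have hb : S b := hS p hp b (hT b (by simp)) (hL ⟨[], w, by simp⟩ h)
    have := forall_mem_of_trapped hL hS w b (hL ⟨[p], [], by simp⟩ h)
      (fun q hq => hT q (by simp [hq])) hb
    intro q hq
    rcases List.mem_cons.1 hq with rfl | hq
    · exact hp
    · exact this q hq

/-- A letter cannot occur twice in a word if the following letters never lead back to it. -/
theorem count_le_one_of_trapped [DecidableEq α]
    (hL : ∀ {v w : List α}, v <:+: w → w ∈ L → v ∈ L) {S : α → Prop}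
    {a : α} (ha : ¬ S a) {v : List α} (hv : v ∈ L) (hstart : ∀ s ∈ v, [a, s] ∈ L → S s)
    (hS : ∀ s, S s → ∀ t ∈ v, [s, t] ∈ L → S t) : v.count a ≤ 1 := by
  by_contra! hcon
  obtain ⟨v₁, v₂, rfl, hv₁⟩ :=
    List.eq_append_cons_of_mem (List.count_pos_iff.1 (Nat.zero_lt_of_lt hcon))
  have h2 : a ∈ v₂ := by
    rw [List.count_append, List.count_eq_zero_of_not_mem hv₁, List.count_cons_self] at hcon
    exact List.count_pos_iff.1 (by omega)
  cases v₂ with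
  | nil => simp at h2
  | cons b v₂ =>
    exact ha (forall_mem_of_trapped hL (T := (· ∈ v₁ ++ a :: b :: v₂)) hS v₂ b
      (hL ⟨v₁ ++ [a], [], by simp⟩ hv) (fun q hq => by simp [hq])
      (hstart b (by simp) (hL ⟨v₁, v₂, by simp⟩ hv)) a h2)

/-- The letter graph is strongly connected and has a fourth letter. -/
theorem IsQuasiSturmianLang.not_forall_mem_triple (h : IsQuasiSturmianLang L) {p q s : α}
    (hpL : [p] ∈ L) (hclosed : ∀ a b, a = p ∨ a = q ∨ a = s → [a, b] ∈ L → b = p ∨ b = q ∨ b = s) :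
    False := by
  obtain ⟨e, he, h1, h2, h3⟩ := h.exists_fourth p q s
  rcases h.forall_of_succ_closed (S := fun a => a = p ∨ a = q ∨ a = s) hclosed hpL (.inl rfl) he
    with h4 | h4 | h4
  exacts [h1 h4, h2 h4, h3 h4]

theorem IsQuasiSturmianLang.not_forall_pred_triple (h : IsQuasiSturmianLang L) {p q s : α}
    (hpL : [p] ∈ L) (hclosed : ∀ a b, a = p ∨ a = q ∨ a = s → [b, a] ∈ L → b = p ∨ b = q ∨ b = s) :
    False :=
  h.reverse.not_forall_mem_triple (p := p) (q := q) (s := s) (by simpa [revLang] using hpL)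
    fun a b ha hab => hclosed a b ha (by simpa [revLang] using hab)

/-- Otherwise `p` and `q` are each other's only successors and form a closed set. -/
theorem IsQuasiSturmianLang.eq_right_special_of_neutral (h : IsQuasiSturmianLang L)
    (hr : IsRightSpecial L r c d) {p q : α} (hpq : [p, q] ∈ L) (hqp : [q, p] ∈ L) :
    p = r ∨ q = r := by
  by_contra! hne
  refine h.not_forall_mem_triple (p := p) (q := q) (s := q) (h.fst_mem hpq) ?_
  rintro a b (rfl | rfl | rfl) hab
  · exact .inr (.inl (hr.succ_unique hne.1 hab hpq))
  all_goals exact .inl (hr.succ_unique hne.2 hab hqp)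

/-- A letter leading to `r` has no successor outside {r, c, d}, so this set would be closed. -/
theorem IsQuasiSturmianLang.neutral_unique (h : IsQuasiSturmianLang L)
    (hr : IsRightSpecial L r c d) (hrc : [c, r] ∈ L) (hrd : [d, r] ∈ L) : False := by
  have key : ∀ a b, [a, b] ∈ L → [a, r] ∈ L → b = r ∨ b = c ∨ b = d := by
    intro a b hab har
    by_cases hbr : b = r
    · exact .inl hbr
    · exact .inr (hr.eq_or_eq b (hr.eq_of_ne a b r hab har hbr ▸ hab))
  refine h.not_forall_mem_triple (p := r) (q := c) (s := d) (h.fst_mem hr.mem_left) ?_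
  rintro a b (rfl | rfl | rfl) hab
  · exact .inr (hr.eq_or_eq b hab)
  · exact key _ b hab hrc
  · exact key _ b hab hrd

/-- The letters `r` and `c` follow each other in both orders. -/
structure IsNeutralPair (L : Set (List α)) (r c d : α) : Prop extends IsRightSpecial L r c d where
  mem_swap : [c, r] ∈ L

theorem IsNeutralPair.eq_of_succ (hn : IsNeutralPair L r c d) {p q : α} (hp : p = r ∨ p = c)
    (hpq : [p, q] ∈ L) : q = r ∨ q = c ∨ q = d := by
  by_cases hpr : p = r
  · subst hpr
    exact .inr (hn.eq_or_eq q hpq)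
  · rcases hp with rfl | rfl
    · exact absurd rfl hpr
    · exact .inl (hn.succ_unique hpr hpq hn.mem_swap)

theorem IsNeutralPair.ne_right (h : IsQuasiSturmianLang L) (hn : IsNeutralPair L r c d) :
    d ≠ r := by
  rintro rfl
  exact h.neutral_unique hn.toIsRightSpecial hn.mem_swap hn.mem_right

theorem IsNeutralPair.eq_of_neutral (h : IsQuasiSturmianLang L) (hn : IsNeutralPair L r c d)
    {p q : α} (hpq : [p, q] ∈ L) (hqp : [q, p] ∈ L) : (p = r ∨ p = c) ∧ (q = r ∨ q = c) := by
  have key : ∀ q, [r, q] ∈ L → [q, r] ∈ L → q = c := by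
    intro q h1 h2
    rcases hn.eq_or_eq q h1 with rfl | rfl
    · rfl
    · exact (h.neutral_unique hn.toIsRightSpecial hn.mem_swap h2).elim
  rcases h.eq_right_special_of_neutral hn.toIsRightSpecial hpq hqp with rfl | rfl
  · exact ⟨.inl rfl, .inr (key q hpq hqp)⟩
  · exact ⟨.inr (key p hqp hpq), .inl rfl⟩

theorem IsQuasiSturmianLang.exists_isNeutralPair (h : IsQuasiSturmianLang L) {p q : α}
    (hpq : [p, q] ∈ L) (hqp : [q, p] ∈ L) : ∃ r c d, IsNeutralPair L r c d := by
  obtain ⟨r, c, d, hr⟩ := h.exists_isRightSpecial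
  have key : ∀ q, [r, q] ∈ L → [q, r] ∈ L → ∃ r c d, IsNeutralPair L r c d := by
    intro q h1 h2
    rcases hr.eq_or_eq q h1 with rfl | rfl
    · exact ⟨_, _, _, hr, h2⟩
    · exact ⟨_, _, _, hr.symm, h2⟩
  rcases h.eq_right_special_of_neutral hr hpq hqp with rfl | rfl
  · exact key q hpq hqp
  · exact key p hqp hpq

theorem IsQuasiSturmianLang.exists_isLeftSpecial (h : IsQuasiSturmianLang L) :
    ∃ l a b, [a, l] ∈ L ∧ [b, l] ∈ L ∧ a ≠ b ∧ (∀ p, [p, l] ∈ L → p = a ∨ p = b) ∧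
      ∀ p p' q, [p, q] ∈ L → [p', q] ∈ L → p ≠ p' → q = l := by
  obtain ⟨l, a, b, hl⟩ := h.reverse.exists_isRightSpecial
  refine ⟨l, a, b, by simpa [revLang] using hl.mem_left, by simpa [revLang] using hl.mem_right,
    hl.ne, fun p hp => hl.eq_or_eq p (by simpa [revLang] using hp), fun p p' q h1 h2 hne =>
      hl.eq_of_ne q p p' (by simpa [revLang] using h1) (by simpa [revLang] using h2) hne⟩

/-- There is only one way into a neutral pair. -/
theorem IsNeutralPair.pred_unique (h : IsQuasiSturmianLang L) (hn : IsNeutralPair L r c d)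
    {p p' s s' : α} (hp : ¬ (p = r ∨ p = c)) (hp' : ¬ (p' = r ∨ p' = c)) (hs : s = r ∨ s = c)
    (hs' : s' = r ∨ s' = c) (h1 : [p, s] ∈ L) (h2 : [p', s'] ∈ L) : p = p' := by
  obtain ⟨l, a, b, -, -, hab, hl, hl'⟩ := h.exists_isLeftSpecial
  have hin : ∀ s, (s = r ∨ s = c) → ∃ q, (q = r ∨ q = c) ∧ [q, s] ∈ L := by
    rintro s (rfl | rfl)
    · exact ⟨c, .inr rfl, hn.mem_swap⟩
    · exact ⟨r, .inl rfl, hn.mem_left⟩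
  -- Each letter of the pair has a predecessor inside the pair, so one entered from outside is the
  -- left special letter, whose second predecessor is then the only entrance.
  have hsl : ∀ p s, ¬ (p = r ∨ p = c) → (s = r ∨ s = c) → [p, s] ∈ L → s = l := by
    intro p s hp hs hps
    obtain ⟨q, hq, hqs⟩ := hin s hs
    exact hl' p q s hps hqs (by rintro rfl; exact hp hq)
  obtain ⟨q, hq, hqs⟩ := hin s hs
  have e1 := hsl p s hp hs h1
  have e2 := hsl p' s' hp' hs' h2
  subst e1
  subst e2
  have hqp : q ≠ p := by rintro rfl; exact hp hq
  have hqp' : q ≠ p' := by rintro rfl; exact hp' hq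
  rcases hl p h1 with rfl | rfl <;> rcases hl p' h2 with rfl | rfl <;>
    rcases hl q hqs with rfl | rfl <;> simp_all

/-- Between two passages through a neutral pair there is the letter `d`. -/
theorem IsNeutralPair.count_le_one [DecidableEq α] (h : IsQuasiSturmianLang L)
    (hn : IsNeutralPair L r c d) {a s : α} (ha : ¬ (a = r ∨ a = c)) (hs : s = r ∨ s = c)
    (has : [a, s] ∈ L) {v : List α} (hv : v ∈ L) (hmem : ∀ x ∈ v, x = a ∨ x = r ∨ x = c) :
    v.count a ≤ 1 := by
  have har : a ≠ r := fun e => ha (.inl e)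
  have hdN : ¬ (d = r ∨ d = c) := by
    rintro (e | e)
    · exact hn.ne_right h e
    · exact hn.ne e.symm
  have had : a ≠ d := by
    rintro rfl
    refine h.not_forall_mem_triple (p := r) (q := c) (s := a) (h.fst_mem hn.mem_left) ?_
    rintro x y (rfl | rfl | rfl) hxy
    · exact hn.eq_of_succ (.inl rfl) hxy
    · exact hn.eq_of_succ (.inr rfl) hxy
    · rw [hn.succ_unique har hxy has]
      exact hs.imp_right .inl
  -- The only way out of the pair is through `d`, which does not occur in `v`.
  refine count_le_one_of_trapped h.mem_of_infix (S := fun x => x = r ∨ x = c) ha hv ?_ ?_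
  · intro x _ hax
    rwa [hn.succ_unique har hax has]
  · intro x hx t ht hxt
    rcases hn.eq_of_succ hx hxt with h1 | h1 | rfl
    · exact .inl h1
    · exact .inr h1
    · rcases hmem t ht with h1 | h1
      · exact absurd h1.symm had
      · exact h1

theorem exists_first_ne : ∀ (t : List α), (∃ x ∈ t, x ≠ r) →
    ∃ (k : ℕ) (s : α) (t' : List α), t = List.replicate k r ++ s :: t' ∧ s ≠ r
  | [], h => by simp at h
  | a :: t, h => by
    by_cases ha : a = r
    · obtain ⟨k, s, t', rfl, hs⟩ := exists_first_ne t (by simpa [ha] using h)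
      exact ⟨k + 1, s, t', by simp [List.replicate_succ, ha], hs⟩
    · exact ⟨0, a, t, by simp, ha⟩

variable [DecidableEq α]

theorem exists_perm_count {M : Set (List α)} (hab : ∀ v ∈ M, ∃ w ∈ L, AbelianEquiv v w)
    {v : List α} {a : α} (hv : v ∈ M) (hcount : 2 ≤ v.count a) :
    ∃ w ∈ L, (∀ x ∈ w, x ∈ v) ∧ ¬ w.count a ≤ 1 := by
  obtain ⟨w, hw, hwv⟩ := exists_perm_of_abelian hab hv
  exact ⟨w, hw, fun x hx => hwv.mem_iff.1 hx, by rw [hwv.count_eq]; omega⟩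

theorem pair_mem_or_mem (hab : ∀ v ∈ M, ∃ w ∈ L, AbelianEquiv v w) {p q : α} (hpq : [p, q] ∈ M) :
    [p, q] ∈ L ∨ [q, p] ∈ L := by
  obtain ⟨w, hw, hwv⟩ := exists_perm_of_abelian hab hpq
  rcases perm_pair_cases hwv with rfl | rfl
  exacts [.inl hw, .inr hw]

/-- Extend `r d r` on both sides across further copies of `r` to the first other letters `s'` and
`s`. Neither is `d`, and both lead into `r`, so they coincide by `pred_unique`. But no word of `L`
over {s, r, d} contains `s` twice. -/
theorem IsQuasiSturmianLang.not_turn_at_loop (h : IsQuasiSturmianLang L)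
    (hM : ∀ {v w : List α}, v <:+: w → w ∈ M → v ∈ M)
    (hright : ∀ x ∈ M, ∃ a, x ++ [a] ∈ M) (hleft : ∀ x ∈ M, ∃ a, a :: x ∈ M)
    (hab : ∀ v ∈ M, ∃ w ∈ L, AbelianEquiv v w) (hn : IsNeutralPair L r r d)
    (hdr' : [d, r] ∉ L) : [r, d, r] ∉ M := by
  intro hmem
  have hdr := hn.ne_right h
  have hdd : [d, d] ∉ L := fun hdd => by
    rcases h.eq_right_special_of_neutral hn.toIsRightSpecial hdd hdd with e | e <;> exact hdr e
  obtain ⟨N, hN⟩ := h.exists_mem_of_abelian hab (h.snd_mem hn.mem_right)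
  obtain ⟨t, ht, hmt⟩ := exists_append_mem hright N _ hmem
  obtain ⟨u, hu, humt⟩ := exists_prepend_mem hleft N _ hmt
  obtain ⟨k, s, t', rfl, hs⟩ := exists_first_ne (r := r) t
    ⟨d, hN t (hM ⟨u ++ [r, d, r], [], by simp⟩ humt) ht.ge, hdr⟩
  obtain ⟨j, s', u', hu', hs'⟩ := exists_first_ne (r := r) u.reverse
    ⟨d, List.mem_reverse.2 (hN u (hM (List.prefix_append _ _).isInfix humt) hu.ge), hdr⟩
  obtain rfl : u = u'.reverse ++ s' :: List.replicate j r := by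
    rw [← List.reverse_inj, hu']; simp
  have hW : s' :: List.replicate j r ++ [r, d, r] ++ List.replicate k r ++ [s] ∈ M :=
    hM ⟨u'.reverse, t', by simp⟩ humt
  have e1 : List.replicate j r ++ [r] = r :: List.replicate j r := by
    rw [← List.replicate_succ', List.replicate_succ]
  have e2 : r :: List.replicate k r = List.replicate k r ++ [r] := by
    rw [← List.replicate_succ', List.replicate_succ]
  have hedge : ∀ s, s ≠ r → s ≠ d → ([r, s] ∈ L ∨ [s, r] ∈ L) → [s, r] ∈ L := by
    rintro s hsr hsd (h1 | h1)
    · rcases hn.eq_or_eq s h1 with e | e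
      · exact absurd e hsr
      · exact absurd e hsd
    · exact h1
  have hrs : [r, s] ∈ M := by
    refine hM ⟨s' :: List.replicate j r ++ [r, d] ++ List.replicate k r, [], ?_⟩ hW
    have : ∀ l : List α, [r, d, r] ++ List.replicate k r ++ l = [r, d] ++ List.replicate k r ++ r :: l := by
      intro l
      rw [show [r, d, r] ++ List.replicate k r = [r, d] ++ (r :: List.replicate k r) by simp, e2]
      simp
    simp only [List.append_assoc, List.cons_append, List.nil_append, List.append_nil] at this ⊢
    rw [this]
  have hrs' : [s', r] ∈ M := by
    refine hM ⟨[], List.replicate j r ++ [d, r] ++ List.replicate k r ++ [s], ?_⟩ hW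
    have : ∀ l : List α, List.replicate j r ++ r :: l = r :: (List.replicate j r ++ l) := by
      intro l
      rw [← List.cons_append, ← e1]
      simp
    simp [this]
  -- In `L` the letter `d` is followed by neither `d` nor `r`.
  have hdcount : ∀ v ∈ M, (∀ x ∈ v, x = d ∨ x = r) → v.count d ≤ 1 := by
    intro v hv hvmem
    by_contra! hcon
    obtain ⟨w, hw, hwv, hw1⟩ := exists_perm_count hab hv (a := d) (by omega)
    refine hw1 (count_le_one_of_trapped h.mem_of_infix (S := fun _ => False) (by simp) hw ?_
      (by simp))
    intro x hx hdx
    rcases hvmem x (hwv x hx) with rfl | rfl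
    · exact hdd hdx
    · exact hdr' hdx
  have hsd : s ≠ d := by
    rintro rfl
    have := hdcount (s :: r :: (List.replicate k r ++ [s]))
      (hM ⟨s' :: List.replicate j r ++ [r], [], by simp⟩ hW)
      (by intro x hx; simp at hx; rcases hx with h | h | ⟨-, h⟩ | h <;> simp [h])
    simp [List.count_cons] at this
  have hsd' : s' ≠ d := by
    rintro rfl
    have := hdcount (s' :: (List.replicate j r ++ [r, s']))
      (hM ⟨[], [r] ++ List.replicate k r ++ [s], by simp⟩ hW)
      (by intro x hx; simp at hx; rcases hx with h | ⟨-, h⟩ | h | h <;> simp [h])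
    simp [List.count_cons] at this
  have hsL := hedge s hs hsd (pair_mem_or_mem hab hrs)
  have hsL' := hedge s' hs' hsd' (pair_mem_or_mem hab hrs').symm
  obtain rfl : s = s' := hn.pred_unique h (by simpa using hs) (by simpa using hs') (.inl rfl)
    (.inl rfl) hsL hsL'
  obtain ⟨w, hw, hwv, hw1⟩ := exists_perm_count hab hW (a := s)
    (by simp [List.count_cons, List.count_append]; omega)
  have hds : [d, s] ∉ L := by
    intro hds
    refine h.not_forall_mem_triple (p := r) (q := d) (s := s) (h.fst_mem hn.mem_left) ?_
    rintro x y (rfl | rfl | rfl) hxy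
    · rcases hn.eq_or_eq y hxy with e | e <;> simp [e]
    · exact .inr (.inr (hn.succ_unique hdr hxy hds))
    · exact .inl (hn.succ_unique hs hxy hsL)
  have hwmem : ∀ x ∈ w, x = s ∨ x = r ∨ x = d := by
    intro x hx
    have := hwv x hx
    simp at this
    tauto
  refine hw1 (count_le_one_of_trapped h.mem_of_infix (S := fun x => x = r ∨ x = d)
    (by simp [hs, hsd]) hw ?_ ?_)
  · exact fun x _ hsx => .inl (hn.succ_unique hs hsx hsL)
  · rintro x (rfl | rfl) t ht hxt
    · exact hn.eq_or_eq t hxt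
    · rcases hwmem t ht with rfl | e
      · exact absurd hxt hds
      · exact e

/-- Here `p` is the right special and `b` the left special letter, so `q` has no neighbours but `p`
and `b`. Prolonging the word beyond `q` gives either `b q b`, no rearrangement of which is in `L`,
or a word over {p, q, b} with two `p`, while in `L` no path inside the triangle returns to `p`. -/
theorem IsQuasiSturmianLang.not_turn_at_triangle (h : IsQuasiSturmianLang L)
    (hM : ∀ {v w : List α}, v <:+: w → w ∈ M → v ∈ M)
    (hright : ∀ x ∈ M, ∃ a, x ++ [a] ∈ M) (hleft : ∀ x ∈ M, ∃ a, a :: x ∈ M)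
    (hab : ∀ v ∈ M, ∃ w ∈ L, AbelianEquiv v w)
    (hneutral : ∀ p q, [p, q] ∈ L → [q, p] ∉ L) {p q b : α} (hqb : [q, b] ∈ L) (hpb : [p, b] ∈ L)
    (hpq : [p, q] ∈ L) : [p, b, q] ∉ M ∧ [q, b, p] ∉ M := by
  obtain ⟨r, c, d, hr⟩ := h.exists_isRightSpecial
  have hne : ∀ x y, [x, y] ∈ L → x ≠ y := by
    rintro x y hxy rfl
    exact hneutral x x hxy hxy
  have hqb' := hne _ _ hqb
  have hpb' := hne _ _ hpb
  have hpq' := hne _ _ hpq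
  obtain rfl : p = r := hr.eq_of_ne p q b hpq hpb hqb'
  obtain ⟨l, a, a', -, -, -, -, hl⟩ := h.exists_isLeftSpecial
  obtain rfl : b = l := hl q p b hqb hpb hpq'.symm
  have hbqb : [b, q, b] ∉ M := by
    intro hmem
    obtain ⟨w, hw, hwv⟩ := exists_perm_of_abelian hab hmem
    have h1 := hneutral _ _ hqb
    have h2 : [b, b] ∉ L := fun h2 => hne _ _ h2 rfl
    rcases perm_triple_cases hwv with rfl | rfl | rfl | rfl | rfl | rfl
    · exact h1 (h.mem_of_infix ⟨[], [b], rfl⟩ hw)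
    · exact h2 (h.mem_of_infix ⟨[q], [], rfl⟩ hw)
    · exact h2 (h.mem_of_infix ⟨[q], [], rfl⟩ hw)
    · exact h2 (h.mem_of_infix ⟨[], [q], rfl⟩ hw)
    · exact h2 (h.mem_of_infix ⟨[], [q], rfl⟩ hw)
    · exact h1 (h.mem_of_infix ⟨[], [b], rfl⟩ hw)
  have htwo : ∀ v ∈ M, (∀ x ∈ v, x = p ∨ x = q ∨ x = b) → v.count p ≤ 1 := by
    intro v hv hvmem
    by_contra! hcon
    obtain ⟨w, hw, hwv, hw1⟩ := exists_perm_count hab hv (a := p) (by omega)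
    refine hw1 (count_le_one_of_trapped h.mem_of_infix (S := fun x => x = q ∨ x = b)
      (by simp [hpq', hpb']) hw ?_ ?_)
    · intro x hx hpx
      rcases hvmem x (hwv x hx) with rfl | e
      · exact absurd rfl (hne _ _ hpx)
      · exact e
    · rintro x (rfl | rfl) t ht hxt
      · exact .inr (hr.succ_unique hpq'.symm hxt hqb)
      · rcases hvmem t (hwv t ht) with rfl | rfl | rfl
        · exact absurd hxt (hneutral _ _ hpb)
        · exact absurd hxt (hneutral _ _ hqb)
        · exact absurd rfl (hne _ _ hxt)
  have hedge : ∀ z, ([q, z] ∈ L ∨ [z, q] ∈ L) → z = b ∨ z = p := by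
    rintro z (h1 | h1)
    · exact .inl (hr.succ_unique hpq'.symm h1 hqb)
    · by_contra! hz
      exact hqb' (hl z p q h1 hpq hz.2)
  constructor
  · intro hmem
    obtain ⟨z, hz⟩ := hright _ hmem
    rcases hedge z (pair_mem_or_mem hab (hM ⟨[p, b], [], by simp⟩ hz)) with rfl | rfl
    · exact hbqb (hM ⟨[p], [], by simp⟩ hz)
    · have := htwo _ hz (by simp)
      simp [List.count_cons] at this
  · intro hmem
    obtain ⟨z, hz⟩ := hleft _ hmem
    rcases hedge z (pair_mem_or_mem hab (hM ⟨[], [b, p], by simp⟩ hz)).symm with rfl | rfl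
    · exact hbqb (hM ⟨[], [p], by simp⟩ hz)
    · have := htwo _ hz (by simp)
      simp [List.count_cons] at this

/-- A path that goes forward, then along letters that allow both directions, cannot go back. -/
theorem IsQuasiSturmianLang.not_turn (h : IsQuasiSturmianLang L)
    (hM : ∀ {v w : List α}, v <:+: w → w ∈ M → v ∈ M)
    (hright : ∀ x ∈ M, ∃ a, x ++ [a] ∈ M) (hleft : ∀ x ∈ M, ∃ a, a :: x ∈ M)
    (hab : ∀ v ∈ M, ∃ w ∈ L, AbelianEquiv v w) {p b b' q : α} {w : List α}
    (hlast : b' ∈ b :: w) (hchain : (b :: w).IsChain fun x y => [x, y] ∈ L ∧ [y, x] ∈ L)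
    (hpb : [p, b] ∈ L) (hbp : [b, p] ∉ L) (hqb : [q, b'] ∈ L) (hbq : [b', q] ∉ L) :
    p :: (b :: w) ++ [q] ∉ M := by
  intro hmem
  -- If `b` belongs to a neutral pair, the walk from `b` stays in it. Then `p` and `q` are both its
  -- only entrance, which a word of `L` over these letters visits at most once.
  have hin : ∀ r c d, IsNeutralPair L r c d → (b = r ∨ b = c) → False := by
    intro r c d hn hb
    have hall : ∀ x ∈ b :: w, x = r ∨ x = c := by
      intro x hx
      rcases List.mem_cons.1 hx with rfl | hx
      · exact hb
      · exact forall_mem_of_isChain (S := fun x => x = r ∨ x = c) (fun x y _ hxy => (hn.eq_of_neutral h hxy.1 hxy.2).2) w b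
          hchain hb x hx
    have hout : ∀ p b, (b = r ∨ b = c) → [p, b] ∈ L → [b, p] ∉ L → ¬ (p = r ∨ p = c) := by
      rintro p b (rfl | rfl) h1 h2 (rfl | rfl)
      exacts [h2 h1, h2 hn.mem_left, h2 hn.mem_swap, h2 h1]
    have hp := hout p b hb hpb hbp
    obtain rfl : p = q := hn.pred_unique h hp (hout q b' (hall b' hlast) hqb hbq) hb
      (hall b' hlast) hpb hqb
    obtain ⟨v, hv, hvw, hv1⟩ := exists_perm_count hab hmem (a := p)
      (by simp)
    refine hv1 (hn.count_le_one h hp hb hpb hv fun x hx => ?_)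
    have := hvw x hx
    simp only [List.mem_append, List.mem_cons, List.not_mem_nil, or_false] at this
    rcases this with (h1 | h1) | h1
    · exact .inl h1
    · exact .inr (hall x (by simpa using h1))
    · exact .inl h1
  cases w with
  | cons b₁ w =>
    rw [List.isChain_cons_cons] at hchain
    obtain ⟨r, c, d, hn⟩ := h.exists_isNeutralPair hchain.1.1 hchain.1.2
    exact hin r c d hn (hn.eq_of_neutral h hchain.1.1 hchain.1.2).1
  | nil =>
  obtain rfl : b' = b := by simpa using hlast
  have hmem : [p, b', q] ∈ M := by simpa using hmem
  rcases eq_or_ne p q with rfl | hpq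
  -- As `b' p` is not in `L`, a rearrangement of `p b' p` in `L` must contain `p p`. So `p` carries
  -- a loop and `b'` is the other successor of `p`.
  · have hpp : [p, p] ∈ L := by
      obtain ⟨v, hv, hvw⟩ := exists_perm_of_abelian hab hmem
      rcases perm_triple_cases hvw with rfl | rfl | rfl | rfl | rfl | rfl
      · exact absurd (h.mem_of_infix ⟨[p], [], rfl⟩ hv) hbp
      · exact h.mem_of_infix ⟨[b'], [], rfl⟩ hv
      · exact h.mem_of_infix ⟨[b'], [], rfl⟩ hv
      · exact h.mem_of_infix ⟨[], [b'], rfl⟩ hv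
      · exact h.mem_of_infix ⟨[], [b'], rfl⟩ hv
      · exact absurd (h.mem_of_infix ⟨[p], [], rfl⟩ hv) hbp
    obtain ⟨r, c, d, hn⟩ := h.exists_isNeutralPair hpp hpp
    have hpb' : b' ≠ p := by rintro rfl; exact hbp hpb
    obtain rfl := hn.eq_of_ne p b' p hpb hpp hpb'
    have hbc : b' ≠ c := fun e => hin p c d hn (.inr e)
    obtain rfl : b' = d := (hn.eq_or_eq b' hpb).resolve_left hbc
    obtain rfl : p = c := by
      rcases hn.eq_or_eq p hpp with e | e
      · exact e
      · exact absurd e.symm hpb'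
    exact h.not_turn_at_loop hM hright hleft hab hn hbp hmem
  · by_cases hneutral : ∀ p q, [p, q] ∈ L → [q, p] ∉ L
    -- A rearrangement in `L` cannot use the edges from `b'` to `p` or `q`, so it contains an edge
    -- between `p` and `q`, which completes a triangle.
    · obtain ⟨v, hv, hvw⟩ := exists_perm_of_abelian hab hmem
      rcases perm_triple_cases hvw with rfl | rfl | rfl | rfl | rfl | rfl
      · exact hbq (h.mem_of_infix ⟨[p], [], rfl⟩ hv)
      · exact hbp (h.mem_of_infix ⟨[], [q], rfl⟩ hv)
      · exact hbq (h.mem_of_infix ⟨[], [p], rfl⟩ hv)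
      · exact (h.not_turn_at_triangle hM hright hleft hab hneutral hqb hpb
          (h.mem_of_infix ⟨[], [b'], rfl⟩ hv)).1 hmem
      · exact (h.not_turn_at_triangle hM hright hleft hab hneutral hpb hqb
          (h.mem_of_infix ⟨[], [b'], rfl⟩ hv)).2 hmem
      · exact hbp (h.mem_of_infix ⟨[q], [], rfl⟩ hv)
    · push Not at hneutral
      obtain ⟨x, y, hxy, hyx⟩ := hneutral
      obtain ⟨r, c, d, hn⟩ := h.exists_isNeutralPair hxy hyx
      refine hin r c d hn ?_
      -- Two predecessors make `b'` the left special letter. If it were outside the neutral pair,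
      -- the pair would be closed under predecessors.
      obtain ⟨l, a, a', -, -, -, -, hl⟩ := h.exists_isLeftSpecial
      obtain rfl : b' = l := hl p q b' hpb hqb hpq
      by_contra! hb
      refine h.not_forall_pred_triple (p := r) (q := c) (s := c) (h.fst_mem hn.mem_left) ?_
      rintro x y (rfl | rfl | rfl) hyx
      · by_contra! hy
        exact hb.1 (hl y c x hyx hn.mem_swap hy.2.1).symm
      all_goals
        by_contra! hy
        exact hb.2 (hl y r x hyx hn.mem_left hy.1).symm

end InfWord

/-! ### Factors of infinite words. -/

namespace InfWord

section Factors

variable {α : Type*}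

@[simp] theorem length_factor (x : ℕ → α) (i n : ℕ) : (factor x i n).length = n := by
  simp [factor]

theorem getElem_factor (x : ℕ → α) (i n k : ℕ) (hk : k < (factor x i n).length) :
    (factor x i n)[k] = x (i + k) := by
  simp [factor]

theorem factor_succ (x : ℕ → α) (i n : ℕ) : factor x i (n + 1) = x i :: factor x (i + 1) n := by
  simp [factor, List.ofFn_succ, Nat.add_comm, Nat.add_left_comm]

theorem factor_append (x : ℕ → α) (i n m : ℕ) :
    factor x i n ++ factor x (i + n) m = factor x i (n + m) := by
  induction n generalizing i with
  | zero => simp [factor]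
  | succ n ih =>
    rw [factor_succ, show i + (n + 1) = i + 1 + n by omega, List.cons_append, ih, ← factor_succ]
    congr 1
    omega

theorem factor_one (x : ℕ → α) (i : ℕ) : factor x i 1 = [x i] := by
  simp [factor]

theorem factor_snoc (x : ℕ → α) (i n : ℕ) : factor x i n ++ [x (i + n)] = factor x i (n + 1) := by
  rw [← factor_append, factor_one]

theorem factor_eq_iff (x y : ℕ → α) (i j n : ℕ) :
    factor x i n = factor y j n ↔ ∀ k < n, x (i + k) = y (j + k) := by
  simp only [factor, List.ofFn_inj, funext_iff, Fin.forall_iff]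

theorem factor_mem_lang (x : ℕ → α) (i n : ℕ) : factor x i n ∈ lang x := ⟨i, n, rfl⟩

theorem lang_infix (x : ℕ → α) {v w : List α} (hvw : v <:+: w) (hw : w ∈ lang x) :
    v ∈ lang x := by
  obtain ⟨s, t, rfl⟩ := hvw
  obtain ⟨i, n, h⟩ := hw
  have hn : n = s.length + v.length + t.length := by
    rw [← length_factor x i n, ← h]
    simp [Nat.add_assoc]
  rw [hn, ← factor_append, ← factor_append] at h
  have h1 := (List.append_inj h (by simp)).1
  exact ⟨i + s.length, v.length, (List.append_inj h1 (by simp)).2⟩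

theorem exists_factor_append (x : ℕ → α) {w : List α} (hw : w ∈ lang x) :
    ∃ a, w ++ [a] ∈ lang x := by
  obtain ⟨i, n, rfl⟩ := hw
  exact ⟨x (i + n), i, n + 1, factor_snoc x i n⟩

theorem IsRecurrent.exists_ge {x : ℕ → α} (h : IsRecurrent x) {w : List α} (hw : w ∈ lang x)
    (N : ℕ) : ∃ i, N ≤ i ∧ factor x i w.length = w := by
  obtain ⟨i, hi, hlt⟩ := (h w hw).exists_gt N
  exact ⟨i, hlt.le, hi⟩

theorem IsRecurrent.exists_factor_cons {x : ℕ → α} (h : IsRecurrent x) {w : List α}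
    (hw : w ∈ lang x) : ∃ a, a :: w ∈ lang x := by
  obtain ⟨i, hi, hiw⟩ := h.exists_ge hw 1
  refine ⟨x (i - 1), i - 1, w.length + 1, ?_⟩
  rw [factor_succ, Nat.sub_add_cancel hi, hiw]

theorem IsRecurrent.irreducible {x : ℕ → α} (h : IsRecurrent x) :
    ∀ v ∈ lang x, ∀ w ∈ lang x, ∃ z, v ++ z ++ w ∈ lang x := by
  rintro _ ⟨i, n, rfl⟩ w hw
  obtain ⟨j, hj, hjw⟩ := h.exists_ge hw (i + n)
  refine ⟨factor x (i + n) (j - (i + n)), i, n + (j - (i + n)) + w.length, ?_⟩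
  rw [← factor_append, ← factor_append, show i + (n + (j - (i + n))) = j by omega, hjw]

theorem shift_iterate_apply (x : ℕ → α) (n k : ℕ) : shift^[n] x k = x (n + k) := by
  induction n generalizing x with
  | zero => simp
  | succ n ih =>
    rw [Function.iterate_succ_apply, ih, shift]
    congr 1
    omega

theorem lang_shift_subset (x : ℕ → α) : lang (shift x) ⊆ lang x := by
  rintro _ ⟨i, n, rfl⟩
  refine ⟨i + 1, n, ?_⟩
  simp [factor, shift, Nat.add_right_comm]

end Factors

/-! ### From the complexity to unique special words. -/

section Collisions

/-- A surjection onto a set with one element fewer has a single two-element fibre and is injective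
elsewhere. Applied to deleting the last or the first letter, it yields the special words and their
two extensions. -/
theorem collision_of_ncard {β γ : Type*} {f : β → γ} {S : Set β} {T : Set γ} (hS : S.Finite)
    (hmaps : Set.MapsTo f S T) (hsurj : Set.SurjOn f S T) (hcard : S.ncard = T.ncard + 1) :
    (∃ a ∈ S, ∃ b ∈ S, a ≠ b ∧ f a = f b) ∧
    ∀ a ∈ S, ∀ b ∈ S, ∀ a' ∈ S, ∀ b' ∈ S, a ≠ b → a' ≠ b' → f a = f b → f a' = f b' →
      f a = f a' ∧ (a' = a ∨ a' = b) := by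
  have himage : f '' S = T := hmaps.image_subset.antisymm hsurj
  constructor
  · by_contra! hcon
    have hinj : Set.InjOn f S := fun a ha b hb hab => by
      by_contra hne
      exact hcon a ha b hb hne hab
    have := hinj.ncard_image
    rw [himage] at this
    omega
  · have key : ∀ a ∈ S, ∀ b ∈ S, ∀ a' ∈ S, ∀ b' ∈ S, a ≠ b → a' ≠ b' → f a = f b →
        f a' = f b' → a' = a ∨ b' = a := by
      intro a ha b hb a' ha' b' hb' hab hab' hf hf'
      by_contra! hne
      have himage' : f '' (S \ {a}) = T := by
        refine Set.Subset.antisymm (by rw [← himage]; exact Set.image_mono Set.sdiff_subset) ?_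
        rw [← himage]
        rintro _ ⟨s, hs, rfl⟩
        by_cases hsa : s = a
        · exact ⟨b, ⟨hb, hab.symm⟩, by rw [hsa, hf]⟩
        · exact ⟨s, ⟨hs, hsa⟩, rfl⟩
      have hcard' := Set.ncard_sdiff_singleton_add_one ha hS
      have hinj : Set.InjOn f (S \ {a}) := by
        rw [← Set.ncard_image_iff hS.sdiff, himage']
        omega
      exact hab' (hinj ⟨ha', hne.1⟩ ⟨hb', hne.2⟩ hf')
    intro a ha b hb a' ha' b' hb' hab hab' hf hf'
    have h1 := key a ha b hb a' ha' b' hb' hab hab' hf hf'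
    have h2 := key b hb a ha a' ha' b' hb' hab.symm hab' hf.symm hf'
    refine ⟨?_, ?_⟩
    · rcases h1 with rfl | rfl
      · rfl
      · exact hf'.symm
    · rcases h1 with h1 | h1
      · exact .inl h1
      · rcases h2 with h2 | h2
        · exact .inr h2
        · exact absurd (h1.symm.trans h2) hab

variable {α : Type*}

theorem isQuasiSturmianLang_lang {u : ℕ → α} {C : ℕ} (hC : 2 < C) (hrec : IsRecurrent u)
    (hcompl : ∀ n : ℕ, 1 ≤ n → complexity u n = n + C) : IsQuasiSturmianLang (lang u) := by
  have hfin : ∀ n, 1 ≤ n → {w | w ∈ lang u ∧ w.length = n}.Finite := fun n hn =>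
    Set.finite_of_ncard_ne_zero (by have := hcompl n hn; rw [complexity] at this; omega)
  have hright := fun n (hn : n ≠ 0) => collision_of_ncard (f := List.dropLast)
    (S := {w | w ∈ lang u ∧ w.length = n + 1}) (T := {w | w ∈ lang u ∧ w.length = n})
    (hfin (n + 1) (by omega))
    (fun w hw => ⟨lang_infix u (List.dropLast_prefix w).isInfix hw.1, by simp [hw.2]⟩)
    (fun w hw => by
      obtain ⟨a, ha⟩ := exists_factor_append u hw.1
      exact ⟨w ++ [a], ⟨ha, by simp [hw.2]⟩, by simp⟩)
    (by have h1 := hcompl n (by omega); have h2 := hcompl (n + 1) (by omega)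
        rw [complexity] at h1 h2; omega)
  -- Recurrence makes `List.tail` surjective, since it lets every factor be extended to the left.
  have hleft := fun n (hn : n ≠ 0) => collision_of_ncard (f := List.tail)
    (S := {w | w ∈ lang u ∧ w.length = n + 1}) (T := {w | w ∈ lang u ∧ w.length = n})
    (hfin (n + 1) (by omega))
    (fun w hw => ⟨lang_infix u (List.tail_suffix w).isInfix hw.1, by simp [hw.2]⟩)
    (fun w hw => by
      obtain ⟨a, ha⟩ := hrec.exists_factor_cons hw.1
      exact ⟨a :: w, ⟨ha, by simp [hw.2]⟩, by simp⟩)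
    (by have h1 := hcompl n (by omega); have h2 := hcompl (n + 1) (by omega)
        rw [complexity] at h1 h2; omega)
  have hsingle : {w | w ∈ lang u ∧ w.length = 1} = (fun a => [a]) '' {a | [a] ∈ lang u} := by
    ext w
    constructor
    · rintro ⟨hw, h1⟩
      obtain ⟨a, rfl⟩ := List.length_eq_one_iff.1 h1
      exact ⟨a, hw, rfl⟩
    · rintro ⟨a, ha, rfl⟩
      exact ⟨ha, rfl⟩
  have hinj : Function.Injective fun a : α => [a] := fun a b hab => by simpa using hab
  refine ⟨lang_infix u, hrec.irreducible, ?_, ?_, ?_, ?_, ?_, ?_⟩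
  · intro x x' a b a' b' hx hlen hab hab' h1 h2 h3 h4
    have := (hright x.length (by simpa using hx)).2 (x ++ [a]) ⟨h1, by simp⟩ (x ++ [b])
      ⟨h2, by simp⟩ (x' ++ [a']) ⟨h3, by simp [hlen]⟩ (x' ++ [b']) ⟨h4, by simp [hlen]⟩
      (by simpa using hab) (by simpa using hab') (by simp) (by simp)
    simp only [List.dropLast_concat] at this
    obtain ⟨rfl, h⟩ := this
    simpa using h
  · intro x x' a b a' b' hx hlen hab hab' h1 h2 h3 h4
    have := (hleft x.length (by simpa using hx)).2 (a :: x) ⟨h1, by simp⟩ (b :: x)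
      ⟨h2, by simp⟩ (a' :: x') ⟨h3, by simp [hlen]⟩ (b' :: x') ⟨h4, by simp [hlen]⟩
      (by simpa using hab) (by simpa using hab') (by simp) (by simp)
    simp only [List.tail_cons] at this
    obtain ⟨rfl, h⟩ := this
    simpa using h
  · intro n hn
    obtain ⟨v, ⟨hv, hvn⟩, w, ⟨hw, hwn⟩, hne, hvw⟩ := (hright n hn).1
    rcases List.eq_nil_or_concat v with rfl | ⟨x, a, rfl⟩
    · simp at hvn
    rcases List.eq_nil_or_concat w with rfl | ⟨y, b, rfl⟩
    · simp at hwn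
    simp only [List.concat_eq_append, List.dropLast_concat] at *
    subst hvw
    exact ⟨x, a, b, by simpa using hvn, by simpa using hne, hv, hw⟩
  · intro n hn
    obtain ⟨v, ⟨hv, hvn⟩, w, ⟨hw, hwn⟩, hne, hvw⟩ := (hleft n hn).1
    cases v with
    | nil => simp at hvn
    | cons a x =>
    cases w with
    | nil => simp at hwn
    | cons b y =>
    simp only [List.tail_cons] at hvw
    subst hvw
    exact ⟨x, a, b, by simpa using hvn, by simpa using hne, hv, hw⟩
  · have := hfin 1 le_rfl
    rw [hsingle] at this
    exact this.of_finite_image hinj.injOn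
  · intro a b c
    have h1 := hcompl 1 le_rfl
    rw [complexity, hsingle, Set.ncard_image_of_injective _ hinj] at h1
    have h2 : ({a, b, c} : Set α).ncard ≤ 3 := by
      refine (Set.ncard_insert_le _ _).trans ?_
      have := Set.ncard_insert_le b ({c} : Set α)
      rw [Set.ncard_singleton] at this
      omega
    obtain ⟨d, hd, hd'⟩ := Set.exists_mem_notMem_of_ncard_lt_ncard
      (s := ({a, b, c} : Set α)) (t := {a | [a] ∈ lang u}) (by omega) (by simp)
    simp only [Set.mem_insert_iff, Set.mem_singleton_iff, not_or] at hd'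
    exact ⟨d, hd, hd'⟩

end Collisions

/-! ### Existence of a reversal, and its different orbit closure. -/

section Reversal

variable {α : Type*} {u : ℕ → α}

theorem isReversal_iff {v : ℕ → α} : IsReversal v u ↔ lang v = revLang (lang u) := by
  rw [IsReversal]
  have : List.reverse '' lang u = revLang (lang u) := by
    ext w
    exact ⟨fun ⟨v, hv, h⟩ => by simpa [← h, revLang] using hv, fun h => ⟨_, h, by simp⟩⟩
  rw [this]

/-- By recurrence there are prefixes of `u`, of growing lengths `n k`, each a suffix of the next.
Their reversals are nested prefixes and converge to the required word. -/
theorem IsRecurrent.exists_isReversal (hrec : IsRecurrent u) : ∃ v, IsReversal v u := by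
  have step : ∀ m k : ℕ, ∃ m', m + k + 1 ≤ m' ∧ ∀ j < m, u (m' - m + j) = u j := by
    intro m k
    obtain ⟨i, hi, hiw⟩ := hrec.exists_ge (factor_mem_lang u 0 m) (k + 1)
    rw [length_factor, factor_eq_iff] at hiw
    refine ⟨i + m, by omega, fun j hj => ?_⟩
    rw [Nat.add_sub_cancel, hiw j hj, Nat.zero_add]
  choose f hf1 hf2 using step
  let n : ℕ → ℕ := fun k => Nat.rec 0 (fun k m => f m k) k
  have hn1 : ∀ k, n k + k + 1 ≤ n (k + 1) := fun k => hf1 (n k) k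
  have hn2 : ∀ k, ∀ j < n k, u (n (k + 1) - n k + j) = u j := fun k => hf2 (n k) k
  have hnk : ∀ k, k ≤ n k := by
    intro k
    cases k with
    | zero => exact Nat.zero_le _
    | succ k => have := hn1 k; omega
  have hmono : ∀ k k', k ≤ k' → ∀ j < n k, j < n k' ∧ u (n k' - 1 - j) = u (n k - 1 - j) := by
    intro k k' hkk' j hj
    induction k', hkk' using Nat.le_induction with
    | base => exact ⟨hj, rfl⟩
    | succ k' _ ih =>
      have h1 := hn1 k'
      refine ⟨by omega, ?_⟩
      rw [← ih.2, ← hn2 k' (n k' - 1 - j) (by omega)]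
      congr 1
      omega
  have hval : ∀ k, ∀ j < n k, u (n (j + 1) - 1 - j) = u (n k - 1 - j) := by
    intro k j hj
    rcases le_total (j + 1) k with h | h
    · exact (hmono _ _ h j (hnk (j + 1))).2.symm
    · exact (hmono _ _ h j hj).2
  -- Any `k` with `j < n k` gives the same letter; `j + 1` is such an index because `k ≤ n k`.
  refine ⟨fun j => u (n (j + 1) - 1 - j), ?_⟩
  have hfac : ∀ i m k, i + m ≤ n k → factor (fun j => u (n (j + 1) - 1 - j)) i m =
      (factor u (n k - i - m) m).reverse := by
    intro i m k hk
    refine List.ext_getElem (by simp) fun j h1 h2 => ?_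
    have hj : j < m := by simpa using h1
    rw [List.getElem_reverse, getElem_factor, getElem_factor, hval k _ (by omega), length_factor]
    congr 1
    omega
  rw [IsReversal]
  ext w
  constructor
  · rintro ⟨i, m, rfl⟩
    exact ⟨_, factor_mem_lang u _ m, (hfac i m (i + m) (hnk _)).symm⟩
  · rintro ⟨_, ⟨i, m, rfl⟩, rfl⟩
    have := hnk (i + m)
    refine ⟨n (i + m) - i - m, m, ?_⟩
    rw [hfac _ m (i + m) (by omega)]
    congr 2
    omega

/-- Equality would make the language closed under reversal, and both successors of `r` would lead
back to `r`. -/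
theorem orbitClosure_ne_of_isReversal (h : IsQuasiSturmianLang (lang u)) (hv : IsReversal v u) :
    orbitClosure u ≠ orbitClosure v := by
  intro heq
  have hu : lang u ⊆ revLang (lang u) := by
    rw [← isReversal_iff.1 hv]
    exact (heq ▸ Set.Subset.rfl : u ∈ orbitClosure v)
  obtain ⟨r, c, d, hr⟩ := h.exists_isRightSpecial
  exact h.neutral_unique hr (by simpa [revLang] using hu hr.mem_left)
    (by simpa [revLang] using hu hr.mem_right)

end Reversal

/-! ### Orbit closures and minimal subshifts. -/

section Subshifts

variable {α : Type*} [TopologicalSpace α]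

theorem IsSubshift.iterate_mem {X : Set (ℕ → α)} (hX : IsSubshift X) {x : ℕ → α} (hx : x ∈ X)
    (n : ℕ) : shift^[n] x ∈ X := by
  induction n with
  | zero => exact hx
  | succ n ih =>
    rw [Function.iterate_succ_apply']
    exact hX.2.2 _ ih

variable [DiscreteTopology α]

theorem mem_closure_iff_prefix {Y : Set (ℕ → α)} {y : ℕ → α} :
    y ∈ closure Y ↔ ∀ N, ∃ z ∈ Y, ∀ k < N, z k = y k := by
  rw [mem_closure_iff]
  constructor
  · intro h N
    obtain ⟨z, hz, hzY⟩ := h ((Finset.range N : Set ℕ).pi fun k => {y k})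
      (isOpen_set_pi (Finset.finite_toSet _) fun _ _ => isOpen_discrete _) (fun k _ => rfl)
    exact ⟨z, hzY, fun k hk => hz k (by simpa using hk)⟩
  · intro h O hO hy
    obtain ⟨I, s, hs, hsub⟩ := isOpen_pi_iff.1 hO y hy
    obtain ⟨z, hzY, hz⟩ := h (I.sup id + 1)
    refine ⟨z, hsub fun k hk => ?_, hzY⟩
    rw [hz k (Nat.lt_succ_of_le (Finset.le_sup (f := id) hk))]
    exact (hs k hk).2

theorem isSubshift_orbitClosure (x : ℕ → α) : IsSubshift (orbitClosure x) := by
  refine ⟨⟨x, Set.Subset.rfl⟩, ?_, fun y hy => (lang_shift_subset y).trans hy⟩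
  refine isClosed_of_closure_subset fun y hy => ?_
  rintro _ ⟨i, n, rfl⟩
  obtain ⟨z, hz, hzy⟩ := mem_closure_iff_prefix.1 hy (i + n)
  rw [show factor y i n = factor z i n from
    (factor_eq_iff _ _ _ _ _).2 fun k hk => (hzy _ (by omega)).symm]
  exact hz (factor_mem_lang z i n)

theorem IsSubshift.orbitClosure_subset {X : Set (ℕ → α)} (hX : IsSubshift X) {x : ℕ → α}
    (hx : x ∈ X) : orbitClosure x ⊆ X := by
  intro z hz
  rw [← hX.2.1.closure_eq, mem_closure_iff_prefix]
  intro N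
  obtain ⟨i, n, h⟩ := hz (factor_mem_lang z 0 N)
  obtain rfl : N = n := by simpa using congrArg List.length h
  rw [factor_eq_iff] at h
  refine ⟨_, hX.iterate_mem hx i, fun k hk => ?_⟩
  rw [shift_iterate_apply, ← h k hk, Nat.zero_add]

/-- By uniform recurrence every point of the orbit closure has the full language of `x`. -/
theorem isMinimalSubshift_orbitClosure {x : ℕ → α} (h : IsQuasiSturmianLang (lang x)) :
    IsMinimalSubshift (orbitClosure x) := by
  refine ⟨isSubshift_orbitClosure x, fun Y hY hYx => hYx.antisymm ?_⟩
  obtain ⟨y, hy⟩ := hY.1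
  refine Set.Subset.trans (fun z (hz : lang z ⊆ lang x) => hz.trans fun w hw => ?_)
    (hY.orbitClosure_subset hy)
  obtain ⟨N, hN⟩ := h.exists_infix_of_length_le hw
  exact lang_infix y (hN (factor y 0 N) (hYx hy (factor_mem_lang y 0 N)) (by simp))
    (factor_mem_lang y 0 N)

theorem IsMinimalSubshift.eq_orbitClosure {X : Set (ℕ → α)} (hX : IsMinimalSubshift X)
    {x : ℕ → α} (hx : x ∈ X) : X = orbitClosure x :=
  (hX.2 _ (isSubshift_orbitClosure x) (hX.1.orbitClosure_subset hx)).symm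

/-- By minimality `x` lies in the orbit closure of each of its shifts, so every factor reappears
beyond any position. -/
theorem IsMinimalSubshift.isRecurrent {X : Set (ℕ → α)} (hX : IsMinimalSubshift X)
    {x : ℕ → α} (hx : x ∈ X) : IsRecurrent x := by
  intro w hw
  refine Set.infinite_of_forall_exists_gt fun N => ?_
  have hmem : x ∈ orbitClosure (shift^[N + 1] x) :=
    hX.eq_orbitClosure (hX.1.iterate_mem hx (N + 1)) ▸ hx
  obtain ⟨i, n, h⟩ := hmem hw
  obtain rfl : w.length = n := by simpa using congrArg List.length h
  refine ⟨N + 1 + i, ?_, by omega⟩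
  change factor x (N + 1 + i) w.length = w
  conv_rhs => rw [h]
  rw [factor_eq_iff]
  intro k _
  rw [shift_iterate_apply, Nat.add_assoc]

end Subshifts

/-! ### Walks of constant direction and the two minimal subshifts. -/

section Main

variable {α : Type*} [DecidableEq α] {L : Set (List α)}

theorem abelian_revLang {M : Set (List α)} (hab : ∀ v ∈ M, ∃ w ∈ L, AbelianEquiv v w) :
    ∀ v ∈ M, ∃ w ∈ revLang L, AbelianEquiv v w := by
  intro v hv
  obtain ⟨w, hw, hvw⟩ := hab v hv
  exact ⟨w.reverse, by simpa [revLang] using hw, fun a => by rw [List.count_reverse, hvw a]⟩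

/-- A recurrent word in the abelian closure is a path that does not change its direction. -/
theorem IsQuasiSturmianLang.forward_or_backward (h : IsQuasiSturmianLang L) {y : ℕ → α}
    (hy : IsRecurrent y) (hab : ∀ v ∈ lang y, ∃ w ∈ L, AbelianEquiv v w) :
    (∀ p q, [p, q] ∈ lang y → [p, q] ∈ L) ∨ (∀ p q, [p, q] ∈ lang y → [q, p] ∈ L) := by
  by_contra! hcon
  obtain ⟨⟨p, q, hpq, hpqL⟩, p', q', hpq', hpqL'⟩ := hcon
  have hedge : ∀ n, [y n, y (n + 1)] ∈ L ∨ [y (n + 1), y n] ∈ L := fun n =>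
    pair_mem_or_mem hab ⟨n, 2, by rw [factor_succ, factor_one]⟩
  have hpair : ∀ n p q, factor y n 2 = [p, q] → y n = p ∧ y (n + 1) = q := by
    intro n p q hn
    rw [factor_succ, factor_one] at hn
    simpa using hn
  -- A step at `m` possible only forwards is followed at `m + k + 1` by one possible only backwards.
  -- At the smallest such distance every step in between is possible both ways, which `not_turn`
  -- excludes.
  have main : ∀ k m, [y (m + 1), y m] ∉ L → [y (m + k + 1), y (m + k + 2)] ∉ L → False := by
    intro k
    induction k using Nat.strong_induction_on with
    | _ k ih =>
    intro m hm hk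
    have hmid : ∀ i < k, [y (m + 1 + i), y (m + 1 + i + 1)] ∈ L ∧
        [y (m + 1 + i + 1), y (m + 1 + i)] ∈ L := by
      intro i hi
      constructor
      · by_contra hcon
        refine ih i hi m hm ?_
        rwa [show m + i + 1 = m + 1 + i by omega, show m + i + 2 = m + 1 + i + 1 by omega]
      · by_contra hcon
        refine ih (k - 1 - i) (by omega) (m + 1 + i) hcon ?_
        rwa [show m + 1 + i + (k - 1 - i) + 1 = m + k + 1 by omega,
          show m + 1 + i + (k - 1 - i) + 2 = m + k + 2 by omega]
    refine h.not_turn (lang_infix y) (fun x hx => exists_factor_append y hx)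
      (fun x hx => hy.exists_factor_cons hx) hab (p := y m) (b := y (m + 1))
      (w := factor y (m + 1 + 1) k) (b' := y (m + 1 + k)) (q := y (m + 1 + k + 1)) ?_ ?_
      ((hedge m).resolve_right hm) hm ?_ ?_ ?_
    · rw [← factor_succ, ← factor_snoc]
      simp
    · rw [← factor_succ, factor, List.isChain_ofFn]
      intro i hi
      exact hmid i (by omega)
    · refine (hedge (m + 1 + k)).resolve_left ?_
      rwa [show m + 1 + k = m + k + 1 by omega]
    · rwa [show m + 1 + k = m + k + 1 by omega]
    · rw [← factor_succ, ← factor_succ, show m + 1 + k + 1 = m + (k + 1 + 1) by omega, factor_snoc]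
      exact factor_mem_lang y _ _
  obtain ⟨m, -, hm⟩ := hy.exists_ge hpq' 0
  obtain ⟨hm1, hm2⟩ := hpair m _ _ hm
  -- Recurrence places a backward-only step after the forward-only one.
  obtain ⟨n, hmn, hn⟩ := hy.exists_ge hpq (m + 1)
  obtain ⟨hn1, hn2⟩ := hpair n _ _ hn
  refine main (n - m - 1) m (by rwa [hm1, hm2]) ?_
  rwa [show m + (n - m - 1) + 1 = n by omega, show m + (n - m - 1) + 2 = n + 1 by omega, hn1, hn2]

variable [TopologicalSpace α] [DiscreteTopology α] {u v : ℕ → α}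

theorem minimalSubshifts_abelianClosure (h : IsQuasiSturmianLang (lang u)) (hv : IsReversal v u) :
    {X : Set (ℕ → α) | IsMinimalSubshift X ∧ X ⊆ abelianClosure u} =
      {orbitClosure u, orbitClosure v} := by
  have hlv := isReversal_iff.1 hv
  have hv' : IsQuasiSturmianLang (lang v) := hlv ▸ h.reverse
  have hminu := isMinimalSubshift_orbitClosure h
  have hminv := isMinimalSubshift_orbitClosure hv'
  ext X
  constructor
  · rintro ⟨hX, hXu⟩
    obtain ⟨y, hy⟩ := hX.1.1
    have hrec := hX.isRecurrent hy
    have hab := hXu hy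
    have hsub : ∀ x : ℕ → α, IsMinimalSubshift (orbitClosure x) → lang y ⊆ lang x →
        X = orbitClosure x := fun x hx hyx =>
      (hX.eq_orbitClosure hy).trans
        (hx.2 _ (isSubshift_orbitClosure y) fun z hz => Set.Subset.trans hz hyx)
    rcases h.forward_or_backward hrec hab with hf | hb
    · exact .inl (hsub u hminu (h.subset_of_abelian (lang_infix y)
        (fun x hx => exists_factor_append y hx) (fun x hx => hrec.exists_factor_cons hx) hab hf))
    · refine .inr (hsub v hminv (hv'.subset_of_abelian (lang_infix y)
        (fun x hx => exists_factor_append y hx) (fun x hx => hrec.exists_factor_cons hx) ?_ ?_))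
      · rw [hlv]
        exact abelian_revLang hab
      · intro p q hpq
        rw [hlv]
        simpa [revLang] using hb p q hpq
  · rintro (rfl | rfl)
    · exact ⟨hminu, fun y hy w hw => ⟨w, hy hw, fun _ => rfl⟩⟩
    · refine ⟨hminv, fun y hy w hw => ⟨w.reverse, ?_, fun a => by rw [List.count_reverse]⟩⟩
      have : w ∈ revLang (lang u) := hlv ▸ hy hw
      exact this

end Main

end InfWord

theorem mainTheorem4 {α : Type*} [DecidableEq α] [TopologicalSpace α] [DiscreteTopology α]
    (u : ℕ → α) (C : ℕ) (hC : 2 < C) (hrec : InfWord.IsRecurrent u)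
    (hcompl : ∀ n : ℕ, 1 ≤ n → InfWord.complexity u n = n + C) :
    {X : Set (ℕ → α) | InfWord.IsMinimalSubshift X ∧ X ⊆ InfWord.abelianClosure u}.encard = 2 ∧
    (∃ v : ℕ → α, InfWord.IsReversal v u) ∧
    ∀ v : ℕ → α, InfWord.IsReversal v u →
      InfWord.orbitClosure u ≠ InfWord.orbitClosure v ∧
      {X : Set (ℕ → α) | InfWord.IsMinimalSubshift X ∧ X ⊆ InfWord.abelianClosure u} =
        {InfWord.orbitClosure u, InfWord.orbitClosure v} := by
  have h := InfWord.isQuasiSturmianLang_lang hC hrec hcompl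
  obtain ⟨v, hv⟩ := hrec.exists_isReversal
  refine ⟨?_, ⟨v, hv⟩, fun w hw => ⟨InfWord.orbitClosure_ne_of_isReversal h hw,
    InfWord.minimalSubshifts_abelianClosure h hw⟩⟩
  rw [InfWord.minimalSubshifts_abelianClosure h hv]
  exact Set.encard_pair (InfWord.orbitClosure_ne_of_isReversal h hv)
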